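/- Let $D$ be a division ring whose center $k$ has characteristic different from $2$, and let $\ast\colon D\to D$ be a $k$-involution, that is, a $k$-linear map with $(xy)^{\ast}=y^{\ast}x^{\ast}$ and $(x^{\ast})^{\ast}=x$ for all $x,y\in D$. Let $N$ be a normal subgroup of the multiplicative group $D^{\bullet}=D\setminus\{0\}$, and let $G$ be a subgroup of $N$ that is torsion-free (no nonidentity element has finite order), nilpotent-by-finite (it has a nilpotent subgroup of finite index) and not abelian-by-finite (it has no abelian subgroup of finite index). Suppose that $G^{\ast}=G$ and $N^{\ast}=N$. Then $N$ contains a free symmetric pair with respect to $\ast$: there are $x,y\in N$ with $x^{\ast}=x$ and $y^{\ast}=y$ such that the subgroup of $D^{\bullet}$ generated by $x$ and $y$ is free and noncyclic. -/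

import Mathlib

/-- A group is torsion-free if its only element of finite order is the identity. (Mathlib's
`IsMulTorsionFree` asks for uniqueness of roots, which is more for noncommutative groups.) -/
def IsTorsionFreeGroup (G : Type*) [Group G] : Prop :=
  ∀ g : G, IsOfFinOrder g → g = 1

/-- A group is abelian-by-finite if it has an abelian subgroup of finite index; this is the
abelian counterpart of Mathlib's `Group.IsVirtuallyNilpotent`. -/
def IsAbelianByFinite (G : Type*) [Group G] : Prop :=
  ∃ A : Subgroup G, (∀ a ∈ A, ∀ b ∈ A, a * b = b * a) ∧ A.FiniteIndex

/-- The involution `star` of the ring `D` is linear over the center of `D`. -/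
def IsCenterLinearStar (D : Type*) [Ring D] [StarRing D] : Prop :=
  ∀ c ∈ Subring.center D, ∀ x : D, star (c * x) = c * star x

/-- A subgroup of the group of units is invariant under the involution. -/
def IsStarInvariant {D : Type*} [Ring D] [StarRing D] (H : Subgroup Dˣ) : Prop :=
  ∀ g ∈ H, star g ∈ H

/-- Two units form a free symmetric pair if both are symmetric and they generate a free
noncyclic subgroup of the group of units. -/
def IsFreeSymmetricPair {D : Type*} [Ring D] [StarRing D] (x y : Dˣ) : Prop :=
  star x = x ∧ star y = y ∧
    IsFreeGroup (Subgroup.closure ({x, y} : Set Dˣ)) ∧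
    ¬ IsCyclic (Subgroup.closure ({x, y} : Set Dˣ))

/-! Since `star` reverses products, g ↦ (star g)⁻¹ is an involutive automorphism of `G`. An
invariant nilpotent subgroup of finite index is nonabelian and torsion-free. Averaging inside its
upper central series yields noncommuting x, y, each fixed or inverted, whose commutator z commutes
with both (`exists_fixed_or_inverted_pair`). Thus x and y are each unitary or symmetric, and z has
infinite order.

In `D` put U₁ = 1 - z⁻¹x, U₂ = 1 - x, U₃ = 1 - zx, V = 1 - y. Then U₁U₂⁻¹ is the commutator of y and
U₂, so w = V⁻¹(U₁U₂⁻¹)V lies in `N`. For each symmetry type, after possibly exchanging x and y,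
conjugating star w by V gives V²(z^e U₃U₂⁻¹)V⁻² or its inverse, with e = 0 or -1
(`exists_free_star_pair`). If w and star w are free generators, so are the symmetric elements w ·
star w and star w · w.

Freeness comes from specialization. Over the center K of the centralizer of z, the elements x and y
generate a quantum plane with parameter z. A valuation ring of K reduces z to a root of unity of
order n ≥ 3 in a residue field F of characteristic other than 2
(`exists_valuationSubring_residue_isPrimitiveRoot`), and the plane reduces to generic clock and
shift matrices over F(X, Y). Clearing denominators by an Ore argument shows that group relations
survive this reduction (`snd_eq_one_of_mem_closure`). For the matrices, clearing denominators and
setting the clock variable to 1 turns both generators and their inverses into matrices of rank one.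
Reduced words then have nonzero reductions, whereas the identity, scaled by the same kind of factor,
reduces to zero (`FreeGroup.lift_injective_of_reducesTo`). -/

/-! ### Reducing a scalar of infinite order to a root of unity -/

/-- The ring of integers is a Jacobson ring. -/
theorem isJacobsonRing_int : IsJacobsonRing ℤ := by
  rw [isJacobsonRing_iff_prime_eq]
  intro P hP
  by_cases h : P = ⊥
  · subst h
    rw [eq_bot_iff]
    intro a ha
    -- Membership in the radical makes `a * a + 1` a unit, hence `1` or `-1`.
    have h1 := Ideal.mem_jacobson_bot.1 ha a
    rw [Int.isUnit_iff] at h1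
    have : a = 0 := by
      rcases h1 with h1 | h1 <;> nlinarith [mul_self_nonneg a]
    simpa using this
  · have := hP.isMaximal h
    exact Ideal.jacobson_eq_self_of_isMaximal

/-- A field that is finitely generated as a ring is finite. -/
theorem Field.finite_of_finiteType_int (F : Type*) [Field F] [Algebra.FiniteType ℤ F] :
    Finite F := by
  have := isJacobsonRing_int
  have hfin : Module.Finite ℤ F := finite_of_finite_type_of_isJacobsonRing ℤ F
  obtain ⟨p, hp⟩ := CharP.exists F
  have hp0 : p ≠ 0 := by
    rintro rfl
    have : CharZero F := CharP.charP_to_charZero F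
    have h2 : IsField ℤ := isField_of_isIntegral_of_isField
      (R := ℤ) (S := F) (RingHom.injective_int (algebraMap ℤ F)) (Field.toIsField F)
    exact Int.not_isField h2
  refine Module.finite_of_fg_torsion F fun a => ?_
  refine ⟨⟨(p : ℤ), by simpa using hp0⟩, ?_⟩
  change (p : ℤ) • a = 0
  simp

/-- An element of infinite multiplicative order of a field has a valuation subring at which it
reduces to a root of unity, different from `1` and `-1`. -/
theorem exists_valuationSubring_residue_isPrimitiveRoot {K : Type*} [Field K] (z : K)
    (hz0 : z ≠ 0) (hz : ∀ m : ℕ, 0 < m → z ^ m ≠ 1) (h2 : (2 : K) ≠ 0) :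
    ∃ (O : ValuationSubring K) (t : Oˣ) (n : ℕ), ((t : O) : K) = z ∧ 3 ≤ n ∧
      IsPrimitiveRoot (IsLocalRing.residue O t) n ∧ (2 : IsLocalRing.ResidueField O) ≠ 0 := by
  classical
  -- Inverting `z ^ 2 - 1` excludes orders `1` and `2` in every residue field; inverting `2`
  -- excludes characteristic `2`.
  let S : Set K := {z, z⁻¹, (z ^ 2 - 1)⁻¹, 2⁻¹}
  let A : Subalgebra ℤ K := Algebra.adjoin ℤ S
  have hSA : S ⊆ A := Algebra.subset_adjoin
  have : Algebra.FiniteType ℤ A := A.fg_iff_finiteType.1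
    ((Subalgebra.fg_def).2 ⟨S, by simp [S], rfl⟩)
  obtain ⟨m, hm⟩ := Ideal.exists_maximal A
  let _ : Field (A ⧸ m) := Ideal.Quotient.field m
  have hquot : Algebra.FiniteType ℤ (A ⧸ m) :=
    Algebra.FiniteType.of_surjective (Ideal.Quotient.mkₐ ℤ m) (Ideal.Quotient.mkₐ_surjective ℤ m)
  have hfin : Finite (A ⧸ m) := @Field.finite_of_finiteType_int _ _ hquot
  let za : A := ⟨z, hSA (by simp [S])⟩
  let za' : A := ⟨z⁻¹, hSA (by simp [S])⟩
  have hzza : za * za' = 1 := Subtype.ext (mul_inv_cancel₀ hz0)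
  obtain ⟨N, hN, hzN⟩ : ∃ N : ℕ, 0 < N ∧ za ^ N - 1 ∈ m := by
    let u : (A ⧸ m)ˣ := ⟨Ideal.Quotient.mk m za, Ideal.Quotient.mk m za',
      by rw [← map_mul, hzza, map_one], by rw [← map_mul, mul_comm, hzza, map_one]⟩
    obtain ⟨N, hN, hu⟩ := isOfFinOrder_iff_pow_eq_one.1 (isOfFinOrder_of_finite u)
    refine ⟨N, hN, ?_⟩
    rw [← Ideal.Quotient.eq_zero_iff_mem, map_sub, map_pow, map_one, sub_eq_zero]
    simpa [u] using congrArg Units.val hu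
  -- A valuation ring containing `A` with `m` among its nonunits: congruences modulo `m`, such as `z
  -- ^ N = 1`, persist in its residue field.
  obtain ⟨O, hAO, hmO⟩ := Ideal.image_subset_nonunits_valuationSubring
    (A := A.toSubring) m hm.ne_top
  have hO : ∀ a ∈ S, a ∈ O := fun a ha => hAO (hSA ha)
  have hunit : ∀ a : K, a ≠ 0 → ∀ h : a ∈ O, a⁻¹ ∈ O → IsUnit (⟨a, h⟩ : O) := fun a h0 h h' =>
    IsUnit.of_mul_eq_one (⟨a⁻¹, h'⟩ : O) (Subtype.ext (mul_inv_cancel₀ h0))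
  let t : Oˣ := ⟨⟨z, hO _ (by simp [S])⟩, ⟨z⁻¹, hO _ (by simp [S])⟩,
    Subtype.ext (mul_inv_cancel₀ hz0), Subtype.ext (inv_mul_cancel₀ hz0)⟩
  have hres1 : IsLocalRing.residue O t ^ N = 1 := by
    have h1 : z ^ N - 1 ∈ O.nonunits := hmO ⟨za ^ N - 1, hzN, rfl⟩
    rw [ValuationSubring.mem_nonunits_iff_exists_mem_maximalIdeal] at h1
    obtain ⟨h3, h4⟩ := h1
    rw [← IsLocalRing.residue_eq_zero_iff] at h4
    rw [← sub_eq_zero, ← h4, ← map_one (IsLocalRing.residue O), ← map_pow, ← map_sub]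
    rfl
  have hz2 : z ^ 2 - 1 ≠ 0 := sub_ne_zero.2 (hz 2 two_pos)
  have hres2 : IsLocalRing.residue O t ^ 2 ≠ 1 := by
    have h3 : z ^ 2 - 1 ∈ O := sub_mem (pow_mem (hO _ (by simp [S])) _) (one_mem _)
    have h1 := (hunit (z ^ 2 - 1) hz2 h3 (hO _ (by simp [S]))).map (IsLocalRing.residue O)
    intro h4
    apply h1.ne_zero
    rw [← sub_eq_zero, ← map_one (IsLocalRing.residue O), ← map_pow, ← map_sub] at h4
    exact h4
  refine ⟨O, t, orderOf (IsLocalRing.residue O t), rfl, ?_, IsPrimitiveRoot.orderOf _, ?_⟩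
  · have h0 : 0 < orderOf (IsLocalRing.residue O t) :=
      orderOf_pos_iff.2 (isOfFinOrder_iff_pow_eq_one.2 ⟨N, hN, hres1⟩)
    have hpow := pow_orderOf_eq_one (IsLocalRing.residue O t)
    by_contra hlt
    have : orderOf (IsLocalRing.residue O t) = 1 ∨ orderOf (IsLocalRing.residue O t) = 2 := by
      omega
    rcases this with h | h <;> rw [h] at hpow
    · exact hres2 (by rw [pow_one] at hpow; rw [hpow, one_pow])
    · exact hres2 hpow
  · have h3 : (2 : K) ∈ O := by
      have := add_mem (one_mem O) (one_mem O)
      rwa [one_add_one_eq_two] at this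
    have h1 := (hunit 2 h2 h3 (hO _ (by simp [S]))).map (IsLocalRing.residue O)
    have h5 : (⟨2, h3⟩ : O) = 2 := rfl
    rw [h5, map_ofNat] at h1
    exact h1.ne_zero

/-! ### Involutive automorphisms of nilpotent groups -/

section GroupTheory

open scoped commutatorElement

variable {H : Type*} [Group H]

/-- If all commutators with `x` are central, then taking the commutator with `x` is a
homomorphism. -/
def commutatorHom (x : H) (hx : ∀ h : H, ⁅x, h⁆ ∈ Subgroup.center H) : H →* H :=
  MonoidHom.mk' (fun h => ⁅x, h⁆) fun a b => by
    have h1 := Subgroup.mem_center_iff.1 (hx b) a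
    have h2 : ⁅x, a * b⁆ = x * a * x⁻¹ * ⁅x, b⁆ * a⁻¹ := by
      simp only [commutatorElement_def]; group
    rw [h2, mul_assoc _ ⁅x, b⁆, ← Subgroup.mem_center_iff.1 (hx b), ← mul_assoc]
    rfl

/-- In a nilpotent nonabelian group some noncentral element has only central commutators. -/
theorem exists_noncentral_of_isNilpotent [Group.IsNilpotent H] (hab : ∃ a b : H, a * b ≠ b * a) :
    ∃ x ∈ Subgroup.upperCentralSeries H 2, x ∉ Subgroup.center H := by
  by_contra! hcon
  have h1 : Subgroup.upperCentralSeries H 1 = Subgroup.upperCentralSeries H 2 := by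
    refine le_antisymm (Subgroup.upperCentralSeries_mono H one_le_two) fun x hx => ?_
    rw [Subgroup.upperCentralSeries_one]
    exact hcon x hx
  have h2 := Subgroup.upperCentralSeries.eq_top (G := H) (by norm_num) h1
  rw [Subgroup.upperCentralSeries_one] at h2
  obtain ⟨a, b, hab⟩ := hab
  have hb : b ∈ Subgroup.center H := h2 ▸ Subgroup.mem_top b
  exact hab (Subgroup.mem_center_iff.1 hb a)

/-- An element that is fixed by an involutive automorphism modulo a term of the upper central
series and modulo the kernel of `θ` can be replaced by a fixed element. -/
theorem exists_fixed_of_mem_upperCentralSeries (φ : H →* H) (hφ : ∀ h, φ (φ h) = h)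
    (θ : H →* H) (hθ : ∀ h, θ h ^ 2 = 1 → θ h = 1)
    (i : ℕ) :
    ∀ y, θ y ≠ 1 → θ (φ y) = θ y → y * (φ y)⁻¹ ∈ Subgroup.upperCentralSeries H i →
      ∃ y', φ y' = y' ∧ θ y' ≠ 1 := by
  induction i with
  | zero =>
    intro y hy _ hc
    rw [Subgroup.upperCentralSeries_zero, Subgroup.mem_bot, mul_inv_eq_one] at hc
    exact ⟨y, hc.symm, hy⟩
  | succ i ih =>
    intro y hy hφy hc
    obtain ⟨c, hcdef⟩ : ∃ c, c = y * (φ y)⁻¹ := ⟨_, rfl⟩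
    rw [← hcdef] at hc
    have hφy' : φ y = c⁻¹ * y := by rw [hcdef]; group
    have hφc : φ c = c⁻¹ := by
      rw [hcdef, map_mul, map_inv, hφ]; group
    have hθc : θ c = 1 := by rw [hcdef, map_mul, map_inv, hφy, mul_inv_cancel]
    have hφ2 : φ (y ^ 2 * c⁻¹) = c⁻¹ * y * (c⁻¹ * y) * c := by
      rw [map_mul, map_inv, map_pow, hφy', hφc, inv_inv, pow_two]
    have hθy : θ (y ^ 2 * c⁻¹) = θ y ^ 2 := by simp [hθc]
    -- Modulo the `i`-th term `c` is central, and there `y ^ 2 * c⁻¹` is the norm `y * φ y`, hence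
    -- fixed. Its `θ`-value is the square of that of `y`, nontrivial by `hθ`.
    refine ih (y ^ 2 * c⁻¹) ?_ ?_ ?_
    · rw [hθy]
      exact fun h => hy (hθ _ h)
    · rw [hφ2, hθy]; simp [hθc, pow_two]
    · rw [hφ2, ← QuotientGroup.eq_one_iff]
      have hcc : ∀ g : H, (c : H ⧸ Subgroup.upperCentralSeries H i) * g = g * c := by
        intro g
        have h1 := (QuotientGroup.eq_one_iff _).2
          (Subgroup.mem_upperCentralSeries_succ_iff.1 hc g)
        rw [commutatorElement_def, QuotientGroup.mk_mul, QuotientGroup.mk_mul,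
          QuotientGroup.mk_mul, QuotientGroup.mk_inv, QuotientGroup.mk_inv] at h1
        rwa [mul_inv_eq_one, mul_inv_eq_iff_eq_mul] at h1
      have hy2 : Commute (c : H ⧸ Subgroup.upperCentralSeries H i) (y : H ⧸ _) := hcc y
      simp only [QuotientGroup.mk_mul, QuotientGroup.mk_inv, QuotientGroup.mk_pow, mul_inv_rev,
        inv_inv]
      have e1 := hy2.inv_right.eq
      generalize (c : H ⧸ Subgroup.upperCentralSeries H i) = C at *
      generalize (y : H ⧸ Subgroup.upperCentralSeries H i) = Y at *
      calc Y ^ 2 * C⁻¹ * (C⁻¹ * (Y⁻¹ * C * (Y⁻¹ * C)))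
          = Y ^ 2 * C⁻¹ * (C⁻¹ * (C * Y⁻¹ * (C * Y⁻¹))) := by rw [e1]
        _ = Y ^ 2 * C⁻¹ * (Y⁻¹ * C * Y⁻¹) := by group
        _ = Y ^ 2 * C⁻¹ * (C * Y⁻¹ * Y⁻¹) := by rw [e1]
        _ = 1 := by group

/-- A nonabelian torsion-free nilpotent group with an involutive automorphism contains two
noncommuting elements, each of them fixed or inverted by the automorphism, whose commutator is
central. -/
theorem exists_fixed_or_inverted_pair (φ : H →* H) (hφ : ∀ h, φ (φ h) = h)
    [Group.IsNilpotent H] (htf : IsTorsionFreeGroup H)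
    (hab : ∃ a b : H, a * b ≠ b * a) :
    ∃ x y : H, (φ x = x ∨ φ x = x⁻¹) ∧ (φ y = y ∨ φ y = y⁻¹) ∧ ⁅x, y⁆ ≠ 1 ∧
      ⁅x, y⁆ ∈ Subgroup.center H := by
  have hsq : ∀ h : H, h ^ 2 = 1 → h = 1 := fun h hh =>
    htf h (isOfFinOrder_iff_pow_eq_one.2 ⟨2, two_pos, hh⟩)
  have hZ2 : ∀ x : H, x ∈ Subgroup.upperCentralSeries H 2 ↔ ∀ h, ⁅x, h⁆ ∈ Subgroup.center H := by
    intro x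
    rw [Subgroup.mem_upperCentralSeries_succ_iff, Subgroup.upperCentralSeries_one]
  have hnc : ∀ x : H, x ∉ Subgroup.center H → ∃ y : H, ⁅x, y⁆ ≠ 1 := by
    intro x hx
    by_contra! h
    refine hx (Subgroup.mem_center_iff.2 fun g => ?_)
    exact (commutatorElement_eq_one_iff_mul_comm.1 (h g)).symm
  obtain ⟨x, hx2, hxc, hφx⟩ : ∃ x ∈ Subgroup.upperCentralSeries H 2, x ∉ Subgroup.center H ∧
      (φ x = x ∨ φ x = x⁻¹) := by
    obtain ⟨x, hx2, hxc⟩ := exists_noncentral_of_isNilpotent hab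
    -- The element `x * (φ x)⁻¹` is always inverted, so it serves unless it is central. In that case
    -- the norm of `x`, written `x ^ 2 * c⁻¹`, is fixed.
    by_cases hc : x * (φ x)⁻¹ ∈ Subgroup.center H
    · obtain ⟨c, hcdef⟩ : ∃ c, c = x * (φ x)⁻¹ := ⟨_, rfl⟩
      rw [← hcdef] at hc
      have hcc := Subgroup.mem_center_iff.1 hc
      have hφx' : φ x = c⁻¹ * x := by rw [hcdef]; group
      have hφc : φ c = c⁻¹ := by
        rw [hcdef, map_mul, map_inv, hφ]; group
      have hc2 : c ∈ Subgroup.upperCentralSeries H 2 :=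
        Subgroup.upperCentralSeries_mono H one_le_two (by rwa [Subgroup.upperCentralSeries_one])
      refine ⟨x ^ 2 * c⁻¹, mul_mem (pow_mem hx2 2) (inv_mem hc2), fun hcen => ?_, Or.inl ?_⟩
      · have h2 : x ^ 2 ∈ Subgroup.center H := by
          have := mul_mem hcen hc
          rwa [inv_mul_cancel_right] at this
        obtain ⟨y, hy⟩ := hnc x hxc
        apply hy
        apply hsq
        have h3 := Subgroup.mem_center_iff.1 ((hZ2 x).1 hx2 y) x
        have h4 := Subgroup.mem_center_iff.1 h2 y
        have h5 : x * y = ⁅x, y⁆ * (y * x) := by simp only [commutatorElement_def]; group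
        -- As `⁅x, y⁆` is central, its square is the commutator of `x ^ 2` and `y`, trivial if `x ^
        -- 2` is central.
        have h6 : ⁅x, y⁆ ^ 2 * (y * x ^ 2) = 1 * (y * x ^ 2) := by
          calc ⁅x, y⁆ ^ 2 * (y * x ^ 2) = ⁅x, y⁆ * (⁅x, y⁆ * (y * x)) * x := by
                simp only [pow_two, mul_assoc]
            _ = (⁅x, y⁆ * x) * (y * x) := by rw [← h5]; simp only [mul_assoc]
            _ = x * (⁅x, y⁆ * (y * x)) := by rw [← h3]; simp only [mul_assoc]
            _ = 1 * (y * x ^ 2) := by rw [← h5, one_mul, h4, pow_two, mul_assoc]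
        exact mul_right_cancel h6
      · rw [map_mul, map_pow, map_inv, hφc, hφx', inv_inv, pow_two, pow_two]
        have e1 : ∀ g, g * c⁻¹ = c⁻¹ * g := Subgroup.mem_center_iff.1 (inv_mem hc)
        calc c⁻¹ * x * (c⁻¹ * x) * c = c⁻¹ * (x * c⁻¹) * (x * c) := by group
          _ = c⁻¹ * (c⁻¹ * x) * (x * c) := by rw [e1 x]
          _ = c⁻¹ * c⁻¹ * (x * x * c) := by group
          _ = x * x * c⁻¹ := by rw [hcc (x * x), e1 (x * x)]; group
    · have hφx2 : φ x ∈ Subgroup.upperCentralSeries H 2 := by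
        let e : H ≃* H := MonoidHom.toMulEquiv φ φ (MonoidHom.ext hφ) (MonoidHom.ext hφ)
        have := Subgroup.comap_upperCentralSeries e 2
        rw [← this] at hx2
        exact hx2
      refine ⟨x * (φ x)⁻¹, mul_mem hx2 (inv_mem hφx2), hc, Or.inr ?_⟩
      rw [map_mul, map_inv, hφ]; group
  have hx2' := (hZ2 x).1 hx2
  obtain ⟨y, hy⟩ := hnc x hxc
  obtain ⟨θ, hθ⟩ : ∃ θ : H →* H, ∀ h, θ h = ⁅x, h⁆ := ⟨commutatorHom x hx2', fun _ => rfl⟩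
  have hcen : ∀ h, θ h ∈ Subgroup.center H := fun h => hθ h ▸ hx2' h
  have key : ∃ y, (φ y = y ∨ φ y = y⁻¹) ∧ θ y ≠ 1 := by
    -- If `θ` is trivial on the inverted element `y * (φ y)⁻¹`, then it agrees on `y` and `φ y`, and
    -- descent from the top of the upper central series gives a fixed element.
    by_cases hc : θ (y * (φ y)⁻¹) = 1
    · obtain ⟨i, hi⟩ := Group.IsNilpotent.nilpotent H
      obtain ⟨y', h1, h2⟩ := exists_fixed_of_mem_upperCentralSeries φ hφ θ
        (fun h => hsq _) i y (by rwa [hθ])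
        (by rw [map_mul, map_inv, mul_inv_eq_one] at hc; exact hc.symm) (hi ▸ Subgroup.mem_top _)
      exact ⟨y', Or.inl h1, h2⟩
    · refine ⟨_, Or.inr ?_, hc⟩
      rw [map_mul, map_inv, hφ]; group
  obtain ⟨y', h1, h2⟩ := key
  exact ⟨x, y', hφx, h1, hθ y' ▸ h2, hx2' y'⟩

end GroupTheory

/-! ### Monomials in two elements commuting up to a scalar -/

section QuantumPlane

variable {O T : Type*} [CommRing O] [Ring T] [Algebra O T]

/-- The monomials in two elements. -/
def monom (ξ η : T) (p : ℕ × ℕ) : T := ξ ^ p.1 * η ^ p.2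

theorem mul_pow_of_qcomm {ξ η : T} {q : O} (h : η * ξ = q • (ξ * η)) (j : ℕ) :
    η ^ j * ξ = q ^ j • (ξ * η ^ j) := by
  induction j with
  | zero => simp
  | succ j ih =>
    rw [pow_succ, mul_assoc, h, mul_smul_comm, ← mul_assoc, ih, smul_mul_assoc, smul_smul,
      mul_assoc, pow_succ' q]

theorem pow_mul_pow_of_qcomm {ξ η : T} {q : O} (h : η * ξ = q • (ξ * η)) (j i : ℕ) :
    η ^ j * ξ ^ i = q ^ (j * i) • (ξ ^ i * η ^ j) := by
  induction i with
  | zero => simp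
  | succ i ih =>
    rw [pow_succ, ← mul_assoc, ih, smul_mul_assoc, mul_assoc, mul_pow_of_qcomm h, mul_smul_comm,
      smul_smul, ← pow_add, ← mul_assoc, mul_add, mul_one]

theorem monom_mul_monom {ξ η : T} {q : O} (h : η * ξ = q • (ξ * η)) (a b : ℕ × ℕ) :
    monom ξ η a * monom ξ η b = q ^ (a.2 * b.1) • monom ξ η (a + b) := by
  unfold monom
  calc ξ ^ a.1 * η ^ a.2 * (ξ ^ b.1 * η ^ b.2) = ξ ^ a.1 * (η ^ a.2 * ξ ^ b.1) * η ^ b.2 := by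
        simp only [mul_assoc]
    _ = q ^ (a.2 * b.1) • (ξ ^ (a + b).1 * η ^ (a + b).2) := by
      rw [pow_mul_pow_of_qcomm h]
      simp only [mul_smul_comm, smul_mul_assoc, Prod.fst_add, Prod.snd_add, pow_add, mul_assoc]

/-- The span of the monomials whose exponents are small. -/
def boxSpan (O : Type*) {T : Type*} [CommRing O] [Ring T] [Algebra O T] (ξ η : T) (d : ℕ) :
    Submodule O T :=
  Submodule.span O (monom ξ η '' ((Finset.range d ×ˢ Finset.range d : Finset (ℕ × ℕ)) : Set _))

theorem mem_boxSpan_of_lt {ξ η : T} {d : ℕ} {p : ℕ × ℕ} (h1 : p.1 < d) (h2 : p.2 < d) :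
    monom ξ η p ∈ boxSpan O ξ η d :=
  Submodule.subset_span ⟨p, by simp [h1, h2], rfl⟩

theorem mul_mem_boxSpan {ξ η : T} {q : O} (h : η * ξ = q • (ξ * η)) {d e : ℕ} {a b : T}
    (ha : a ∈ boxSpan O ξ η d) (hb : b ∈ boxSpan O ξ η e) : a * b ∈ boxSpan O ξ η (d + e) := by
  have h1 : boxSpan O ξ η d * boxSpan O ξ η e ≤ boxSpan O ξ η (d + e) := by
    unfold boxSpan
    rw [Submodule.span_mul_span, Submodule.span_le]
    rintro _ ⟨_, ⟨p, hp, rfl⟩, _, ⟨r, hr, rfl⟩, rfl⟩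
    simp only [Finset.coe_product, Finset.coe_range, Set.mem_prod, Set.mem_Iio] at hp hr
    simp only [monom_mul_monom h]
    refine Submodule.smul_mem _ _ (mem_boxSpan_of_lt ?_ ?_)
    · simp only [Prod.fst_add]; omega
    · simp only [Prod.snd_add]; omega
  exact h1 (Submodule.mul_mem_mul ha hb)

/-- The span of all monomials in two elements. -/
def planeSpan (O : Type*) {T : Type*} [CommRing O] [Ring T] [Algebra O T] (ξ η : T) :
    Submodule O T :=
  Submodule.span O (Set.range (monom ξ η))

theorem boxSpan_le_planeSpan (ξ η : T) (d : ℕ) : boxSpan O ξ η d ≤ planeSpan O ξ η :=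
  Submodule.span_mono (Set.image_subset_range _ _)

theorem exists_mem_boxSpan {ξ η a : T} (ha : a ∈ planeSpan O ξ η) :
    ∃ d, ∀ e, d ≤ e → a ∈ boxSpan O ξ η e := by
  unfold planeSpan at ha
  induction ha using Submodule.span_induction with
  | mem a ha =>
    obtain ⟨p, rfl⟩ := ha
    exact ⟨p.1 + p.2 + 1, fun e he => mem_boxSpan_of_lt (by omega) (by omega)⟩
  | zero => exact ⟨0, fun e _ => zero_mem _⟩
  | add a b _ _ iha ihb =>
    obtain ⟨d, hd⟩ := iha
    obtain ⟨d', hd'⟩ := ihb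
    exact ⟨max d d', fun e he => add_mem (hd e (le_trans (le_max_left _ _) he))
      (hd' e (le_trans (le_max_right _ _) he))⟩
  | smul c a _ ih =>
    obtain ⟨d, hd⟩ := ih
    exact ⟨d, fun e he => Submodule.smul_mem _ _ (hd e he)⟩

theorem mul_mem_planeSpan {ξ η : T} {q : O} (h : η * ξ = q • (ξ * η)) {a b : T}
    (ha : a ∈ planeSpan O ξ η) (hb : b ∈ planeSpan O ξ η) : a * b ∈ planeSpan O ξ η := by
  obtain ⟨d, hd⟩ := exists_mem_boxSpan ha
  obtain ⟨e, he⟩ := exists_mem_boxSpan hb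
  exact boxSpan_le_planeSpan _ _ _ (mul_mem_boxSpan h (hd d le_rfl) (he e le_rfl))

theorem monom_mem_planeSpan (ξ η : T) (p : ℕ × ℕ) : monom ξ η p ∈ planeSpan O ξ η :=
  Submodule.subset_span ⟨p, rfl⟩

theorem one_mem_planeSpan (ξ η : T) : (1 : T) ∈ planeSpan O ξ η := by
  simpa [monom] using monom_mem_planeSpan (O := O) ξ η (0, 0)

theorem left_mem_planeSpan (ξ η : T) : ξ ∈ planeSpan O ξ η := by
  simpa [monom] using monom_mem_planeSpan (O := O) ξ η (1, 0)

theorem right_mem_planeSpan (ξ η : T) : η ∈ planeSpan O ξ η := by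
  simpa [monom] using monom_mem_planeSpan (O := O) ξ η (0, 1)

end QuantumPlane

/-- Finitely many elements of a field, not all zero, can be scaled into a valuation subring so
that one of them becomes `1`. -/
theorem ValuationSubring.exists_scaling {K ι : Type*} [Field K] [Finite ι] (O : ValuationSubring K)
    (v : ι → K) (hv : v ≠ 0) : ∃ (c : K) (o : ι → O), (∀ i, (o i : K) = c * v i) ∧ ∃ i, o i = 1 := by
  classical
  cases nonempty_fintype ι
  obtain ⟨j, hj⟩ := Function.ne_iff.1 hv
  obtain ⟨i, -, hi⟩ := Finset.exists_max_image Finset.univ (fun i => O.valuation (v i))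
    ⟨j, Finset.mem_univ j⟩
  have hi0 : v i ≠ 0 := by
    intro h0
    have := hi j (Finset.mem_univ j)
    rw [h0, map_zero, le_zero_iff, map_eq_zero] at this
    exact hj this
  have hmem : ∀ k, (v i)⁻¹ * v k ∈ O := by
    intro k
    rw [← O.valuation_le_one_iff, map_mul, map_inv₀]
    have hpos : 0 < O.valuation (v i) := zero_lt_iff.2 ((Valuation.ne_zero_iff _).2 hi0)
    rw [inv_mul_le_iff₀ hpos, mul_one]
    exact hi k (Finset.mem_univ k)
  exact ⟨(v i)⁻¹, fun k => ⟨_, hmem k⟩, fun k => rfl, i, Subtype.ext (inv_mul_cancel₀ hi0)⟩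

/-! ### Transfer of relations from the generic plane to its specialization -/

section Specialization

variable {K E F M : Type*} [Field K] [DivisionRing E] [Algebra K E] [Field F] [Ring M] [Algebra F M]
  (O : ValuationSubring K) [Algebra O E] [IsScalarTower O K E] [Algebra O F] [Algebra O M]
  [IsScalarTower O F M]

/-- Independence over `K` forces all coefficients in `O` to vanish with the first component. Hence
specialization is well defined on the span. -/
theorem snd_eq_zero_of_fst_eq_zero {x y : E} {x' y' : M}
    (hli : LinearIndependent K (monom x y)) {t : E × M}
    (ht : t ∈ planeSpan O ((x, x') : E × M) (y, y')) (h0 : t.1 = 0) : t.2 = 0 := by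
  unfold planeSpan at ht
  rw [← Set.image_univ, Finsupp.mem_span_image_iff_linearCombination] at ht
  obtain ⟨c, -, rfl⟩ := ht
  have h1 : ∀ p, c p = 0 := by
    have hli' : LinearIndependent O (monom x y) := hli.restrict_scalars' O
    rw [linearIndependent_iff] at hli'
    have : Finsupp.linearCombination O (monom x y) c = 0 := by
      rw [← h0]
      simp [Finsupp.linearCombination_apply, Finsupp.sum, Prod.fst_sum, monom]
    exact fun p => by rw [hli' c this]; rfl
  have : c = 0 := Finsupp.ext h1
  simp [this]

end Specialization

section Specialization

variable {K E F M : Type*} [Field K] [DivisionRing E] [Algebra K E] [Field F] [Ring M] [Algebra F M]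
  (O : ValuationSubring K) [Algebra O E] [IsScalarTower O K E] [Algebra O F] [Algebra O M]
  [IsScalarTower O F M]

theorem fst_mem_boxSpan {x y : E} {x' y' : M} {d : ℕ} {t : E × M}
    (ht : t ∈ boxSpan O ((x, x') : E × M) (y, y') d) : t.1 ∈ boxSpan K x y d := by
  unfold boxSpan at ht
  induction ht using Submodule.span_induction with
  | mem a ha =>
    obtain ⟨p, hp, rfl⟩ := ha
    exact Submodule.subset_span ⟨p, hp, rfl⟩
  | zero => exact zero_mem _
  | add a b _ _ iha ihb => exact add_mem iha ihb
  | smul c a _ ih =>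
    rw [Prod.smul_fst, ← algebraMap_smul K c]
    exact Submodule.smul_mem _ _ ih

theorem finrank_boxSpan_le (x y : E) (d : ℕ) :
    Module.finrank K (boxSpan K x y d) ≤ d * d := by
  classical
  unfold boxSpan
  rw [← Finset.coe_image]
  refine (finrank_span_finset_le_card _).trans (Finset.card_image_le.trans ?_)
  simp

theorem finiteDimensional_boxSpan (x y : E) (d : ℕ) :
    FiniteDimensional K (boxSpan K x y d) :=
  FiniteDimensional.span_of_finite K ((Finset.finite_toSet _).image _)

theorem isUnit_sum_smul_monom {B : Type*} [Fintype B] {x' y' : M} (e : B → ℕ × ℕ)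
    (he : Function.Injective e)
    (hunit : ∀ c : ℕ × ℕ →₀ F, c ≠ 0 → IsUnit (Finsupp.linearCombination F (monom x' y') c))
    (o : B → O) (b : B) (hb : algebraMap O F (o b) ≠ 0) :
    IsUnit (∑ b, o b • monom x' y' (e b)) := by
  classical
  let c : ℕ × ℕ →₀ F := ∑ b, Finsupp.single (e b) (algebraMap O F (o b))
  have hc : c ≠ 0 := by
    intro h0
    have h1 := DFunLike.congr_fun h0 (e b)
    simp only [c, Finsupp.coe_finsetSum, Finset.sum_apply, Finsupp.single_apply,
      Finsupp.coe_zero, Pi.zero_apply, he.eq_iff, Finset.sum_ite_eq', Finset.mem_univ,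
      if_true] at h1
    exact hb h1
  convert hunit c hc
  simp [c, map_sum]

/-- The local Ore condition for pairs of corresponding elements of two quantum planes. -/
theorem exists_ore_of_isUnit_snd [Nontrivial M] {x y : E} {x' y' : M} {q : O}
    (hli : LinearIndependent K (monom x y))
    (hunit : ∀ c : ℕ × ℕ →₀ F, c ≠ 0 → IsUnit (Finsupp.linearCombination F (monom x' y') c))
    (hq : ((y, y') : E × M) * (x, x') = q • ((x, x') * (y, y'))) {a s : E × M}
    (ha : a ∈ planeSpan O ((x, x') : E × M) (y, y'))
    (hs : s ∈ planeSpan O ((x, x') : E × M) (y, y')) (hs2 : IsUnit s.2) :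
    ∃ a' ∈ planeSpan O ((x, x') : E × M) (y, y'), ∃ s' ∈ planeSpan O ((x, x') : E × M) (y, y'),
      IsUnit s'.2 ∧ a * s' = s * a' := by
  classical
  obtain ⟨d, hd⟩ := exists_mem_boxSpan ha
  obtain ⟨d', hd'⟩ := exists_mem_boxSpan hs
  obtain ⟨D, hD, hD1, hD2⟩ : ∃ D, 0 < D ∧ d ≤ D ∧ d' ≤ D := ⟨d + d' + 1, by omega, by omega, by omega⟩
  have ha1 := hd D hD1
  have hs1 := hd' D hD2
  -- Dimension count: two unknown elements with `9 * D ^ 2` coefficients each, against a target of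
  -- dimension at most `(4 * D) ^ 2`. Since `18 > 16`, the equation `a * s' = s * a'` has a nonzero
  -- solution over `K`.
  let B := Fin (3 * D) × Fin (3 * D)
  let e : B → ℕ × ℕ := fun b => (b.1, b.2)
  have he : Function.Injective e := by
    rintro ⟨b1, b2⟩ ⟨c1, c2⟩ h
    rw [Prod.mk.injEq] at h
    exact Prod.ext (Fin.ext h.1) (Fin.ext h.2)
  have hmem : ∀ b : B, monom x y (e b) ∈ boxSpan K x y (3 * D) := fun b =>
    mem_boxSpan_of_lt b.1.2 b.2.2
  have hqE : y * x = (q : K) • (x * y) := by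
    have := congrArg Prod.fst hq
    simp only [Prod.fst_mul, Prod.smul_fst] at this
    rw [this, ← algebraMap_smul K q]
    rfl
  let g : B ⊕ B → E := Sum.elim (fun b => a.1 * monom x y (e b)) (fun b => -(s.1 * monom x y (e b)))
  have hg : ∀ i, g i ∈ boxSpan K x y (D + 3 * D) := by
    rintro (b | b)
    · exact mul_mem_boxSpan hqE (fst_mem_boxSpan O ha1) (hmem b)
    · exact neg_mem (mul_mem_boxSpan hqE (fst_mem_boxSpan O hs1) (hmem b))
  let f : (B ⊕ B → K) →ₗ[K] boxSpan K x y (D + 3 * D) :=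
    (Fintype.linearCombination K g).codRestrict _ fun v => by
      rw [Fintype.linearCombination_apply]
      exact Submodule.sum_mem _ fun i _ => Submodule.smul_mem _ _ (hg i)
  have := finiteDimensional_boxSpan (K := K) x y (D + 3 * D)
  have hker : LinearMap.ker f ≠ ⊥ := by
    apply LinearMap.ker_ne_bot_of_finrank_lt
    refine (finrank_boxSpan_le x y (D + 3 * D)).trans_lt ?_
    simp only [Module.finrank_fintype_fun_eq_card, Fintype.card_sum, Fintype.card_prod,
      Fintype.card_fin, B]
    nlinarith
  obtain ⟨v, hv, hv0⟩ := Submodule.exists_mem_ne_zero_of_ne_bot hker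
  -- Scaling makes the solution integral with one coefficient `1`, so that it does not vanish in the
  -- residue field.
  obtain ⟨c, o, ho, i, hi⟩ := O.exists_scaling v hv0
  have hfv : ∑ i, v i • g i = 0 := by
    have := congrArg Subtype.val (LinearMap.mem_ker.1 hv)
    simpa [f, Fintype.linearCombination_apply] using this
  let mon : B → E × M := fun b => monom ((x, x') : E × M) (y, y') (e b)
  have hmon1 : ∀ b, (mon b).1 = monom x y (e b) := fun b => rfl
  have hmon2 : ∀ b, (mon b).2 = monom x' y' (e b) := fun b => rfl
  let s' : E × M := ∑ b, o (Sum.inl b) • mon b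
  let a' : E × M := ∑ b, o (Sum.inr b) • mon b
  have hs' : s' ∈ planeSpan O ((x, x') : E × M) (y, y') :=
    Submodule.sum_mem _ fun b _ => Submodule.smul_mem _ _ (monom_mem_planeSpan _ _ _)
  have ha' : a' ∈ planeSpan O ((x, x') : E × M) (y, y') :=
    Submodule.sum_mem _ fun b _ => Submodule.smul_mem _ _ (monom_mem_planeSpan _ _ _)
  have hsm : ∀ (i) (w : E), o i • w = c • v i • w := by
    intro i w
    rw [← algebraMap_smul K (o i), smul_smul, ← ho i]
    rfl
  have h1 : (a * s' - s * a').1 = 0 := by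
    have : (a * s' - s * a').1 = c • ∑ i, v i • g i := by
      have e1 : s'.1 = ∑ b, o (Sum.inl b) • monom x y (e b) := by
        simp only [s', Prod.fst_sum, Prod.smul_fst, hmon1]
      have e2 : a'.1 = ∑ b, o (Sum.inr b) • monom x y (e b) := by
        simp only [a', Prod.fst_sum, Prod.smul_fst, hmon1]
      rw [Prod.fst_sub, Prod.fst_mul, Prod.fst_mul, e1, e2]
      simp only [hsm, Fintype.sum_sum_type, g, Sum.elim_inl, Sum.elim_inr, smul_neg, Finset.sum_neg_distrib,
        smul_add, Finset.smul_sum, Finset.mul_sum, mul_smul_comm, sub_eq_add_neg]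
    rw [this, hfv, smul_zero]
  have h2 : (a * s' - s * a').2 = 0 := snd_eq_zero_of_fst_eq_zero O hli
    (sub_mem (mul_mem_planeSpan hq ha hs') (mul_mem_planeSpan hq hs ha')) h1
  have h3 : a * s' = s * a' := sub_eq_zero.1 (Prod.ext h1 h2)
  have hs'2 : s'.2 = ∑ b, o (Sum.inl b) • monom x' y' (e b) := by
    simp only [s', Prod.snd_sum, Prod.smul_snd, hmon2]
  have ha'2 : a'.2 = ∑ b, o (Sum.inr b) • monom x' y' (e b) := by
    simp only [a', Prod.snd_sum, Prod.smul_snd, hmon2]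
  refine ⟨a', ha', s', hs', ?_, h3⟩
  -- If all coefficients of `s'` reduced to zero, then `s.2 * a'.2 = 0`, so `a'.2 = 0`; but the
  -- coefficient `1` would then belong to `a'` and make `a'.2` a unit.
  by_cases hall : ∃ b, algebraMap O F (o (Sum.inl b)) ≠ 0
  · obtain ⟨b, hb⟩ := hall
    rw [hs'2]
    exact isUnit_sum_smul_monom O e he hunit (fun b => o (Sum.inl b)) b hb
  · exfalso
    push Not at hall
    have hs0 : s'.2 = 0 := by
      rw [hs'2]
      refine Finset.sum_eq_zero fun b _ => ?_
      rw [← algebraMap_smul F, hall b, zero_smul]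
    have h4 := congrArg Prod.snd h3
    rw [Prod.snd_mul, Prod.snd_mul, hs0, mul_zero] at h4
    have ha0 : a'.2 = 0 := (hs2.mul_right_eq_zero).1 h4.symm
    rcases i with b | b
    · have := hall b
      rw [hi, map_one] at this
      exact one_ne_zero this
    · have hu : IsUnit a'.2 := by
        rw [ha'2]
        refine isUnit_sum_smul_monom O e he hunit (fun b => o (Sum.inr b)) b ?_
        rw [hi, map_one]
        exact one_ne_zero
      exact hu.ne_zero ha0

/-- Relations between units of the generic quantum plane also hold after specialization. -/
theorem snd_eq_one_of_mem_closure [Nontrivial M] {x y : E} {x' y' : M} {q : O}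
    (hli : LinearIndependent K (monom x y))
    (hunit : ∀ c : ℕ × ℕ →₀ F, c ≠ 0 → IsUnit (Finsupp.linearCombination F (monom x' y') c))
    (hq : ((y, y') : E × M) * (x, x') = q • ((x, x') * (y, y'))) {g : Eˣ × Mˣ}
    (hg : g ∈ Subgroup.closure {t : Eˣ × Mˣ |
      ((t.1 : E), (t.2 : M)) ∈ planeSpan O ((x, x') : E × M) (y, y')}) (h1 : g.1 = 1) :
    g.2 = 1 := by
  -- Every element of the subgroup is a right fraction whose denominator specializes to a unit; the
  -- Ore condition handles multiplication by an inverse on the left.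
  have key : ∃ a ∈ planeSpan O ((x, x') : E × M) (y, y'),
      ∃ s ∈ planeSpan O ((x, x') : E × M) (y, y'), IsUnit s.2 ∧
        ((g.1 : E), (g.2 : M)) * s = a := by
    clear h1
    induction hg using Subgroup.closure_induction_left with
    | one => exact ⟨1, one_mem_planeSpan _ _, 1, one_mem_planeSpan _ _, isUnit_one, mul_one _⟩
    | mul_left t ht g _ ih =>
      obtain ⟨a, ha, s, hs, hs2, h⟩ := ih
      refine ⟨((t.1 : E), (t.2 : M)) * a, mul_mem_planeSpan hq ht ha, s, hs, hs2, ?_⟩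
      rw [← h, ← mul_assoc]
      rfl
    | inv_mul_cancel t ht g _ ih =>
      obtain ⟨a, ha, s, hs, hs2, h⟩ := ih
      obtain ⟨a', ha', s', hs', hs'2, h'⟩ := exists_ore_of_isUnit_snd O hli hunit hq ha ht t.2.isUnit
      refine ⟨a', ha', s * s', mul_mem_planeSpan hq hs hs', hs2.mul hs'2, ?_⟩
      have e1 : (((t⁻¹ * g).1 : E), ((t⁻¹ * g).2 : M)) =
          (((t⁻¹).1 : E), ((t⁻¹).2 : M)) * ((g.1 : E), (g.2 : M)) := rfl
      have e2 : (((t⁻¹).1 : E), ((t⁻¹).2 : M)) * ((t.1 : E), (t.2 : M)) = 1 := by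
        ext <;> simp
      rw [e1, mul_assoc, ← mul_assoc _ s s', h, h', ← mul_assoc, e2, one_mul]
  obtain ⟨a, ha, s, hs, hs2, h⟩ := key
  have h2 : (a - s).2 = 0 := by
    refine snd_eq_zero_of_fst_eq_zero O hli (sub_mem ha hs) ?_
    rw [← h]
    simp [h1]
  rw [← h] at h2
  have h3 : ((g.2 : M) - 1) * s.2 = 0 := by
    rw [sub_mul, one_mul]
    exact h2
  have h4 := (hs2.mul_left_eq_zero).1 h3
  exact Units.ext (sub_eq_zero.1 h4)

end Specialization

/-- The monomials in two `z`-commuting elements of a division algebra are linearly independent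
if `z` has infinite order. -/
theorem linearIndependent_monom {K E : Type*} [Field K] [DivisionRing E] [Algebra K E] {x y : E}
    {z : K} (hx : x ≠ 0) (hy : y ≠ 0) (hz0 : z ≠ 0) (hz : ∀ m : ℕ, 0 < m → z ^ m ≠ 1)
    (hxy : x * y = z • (y * x)) : LinearIndependent K (monom x y) := by
  have hinj : ∀ a b : ℕ, z ^ a = z ^ b → a = b := by
    have key : ∀ a b : ℕ, a ≤ b → z ^ a = z ^ b → a = b := by
      intro a b hab h
      by_contra hne
      obtain ⟨k, rfl⟩ := Nat.exists_eq_add_of_le hab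
      refine hz k (by omega) ?_
      rw [pow_add] at h
      exact mul_left_cancel₀ (pow_ne_zero a hz0) (by rw [← h, mul_one])
    intro a b h
    rcases le_total a b with hab | hab
    · exact key a b hab h
    · exact (key b a hab h.symm).symm
  rw [linearIndependent_iff_finset_linearIndependent]
  intro s
  obtain ⟨B, hB⟩ : ∃ B : ℕ, ∀ p ∈ s, p.2 < B :=
    ⟨s.sup Prod.snd + 1, fun p hp => Nat.lt_succ_of_le (Finset.le_sup (f := Prod.snd) hp)⟩
  -- Conjugation by `x * (y ^ B)⁻¹`. The monomial with exponents `(i, j)` has eigenvalue `z ^ (i * B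
  -- + j)`; as `j < B`, division by `B` recovers `(i, j)`, so the eigenvalues are distinct.
  let f : Module.End K E := LinearMap.mulLeft K (x * (y ^ B)⁻¹) * LinearMap.mulRight K (y ^ B * x⁻¹)
  have hf : ∀ p : ℕ × ℕ, f (monom x y p) = z ^ (p.1 * B + p.2) • monom x y p := by
    intro p
    have h1 : monom x y p * y ^ B = z ^ (p.1 * B) • (y ^ B * monom x y p) := by
      unfold monom
      rw [mul_assoc, ← pow_add, add_comm, pow_add, ← mul_assoc, pow_mul_pow_of_qcomm hxy,
        smul_mul_assoc, mul_assoc]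
    have h2 : x * monom x y p = z ^ p.2 • (monom x y p * x) := by
      unfold monom
      have := pow_mul_pow_of_qcomm hxy 1 p.2
      rw [one_mul, pow_one] at this
      rw [← mul_assoc, ← pow_succ', pow_succ, mul_assoc, this, mul_smul_comm, mul_assoc]
    calc f (monom x y p) = x * (y ^ B)⁻¹ * (monom x y p * (y ^ B * x⁻¹)) := rfl
      _ = z ^ (p.1 * B) • (x * ((y ^ B)⁻¹ * y ^ B) * monom x y p * x⁻¹) := by
        rw [← mul_assoc (monom x y p), h1]
        simp only [smul_mul_assoc, mul_smul_comm, mul_assoc]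
      _ = z ^ (p.1 * B + p.2) • monom x y p := by
        rw [inv_mul_cancel₀ (pow_ne_zero _ hy), mul_one, h2, smul_mul_assoc, mul_assoc,
          mul_inv_cancel₀ hx, mul_one, smul_smul, ← pow_add]
  refine Module.End.eigenvectors_linearIndependent' f (fun p : s => z ^ (p.1.1 * B + p.1.2)) ?_ _ ?_
  · rintro ⟨⟨i, j⟩, hp⟩ ⟨⟨i', j'⟩, hp'⟩ h
    have h1 := hinj _ _ h
    have h2 := hB _ hp
    have h3 := hB _ hp'
    simp only at h1 h2 h3
    have h4 : j = j' := by
      have := congrArg (· % B) h1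
      simpa [Nat.add_mod, Nat.mod_eq_of_lt h2, Nat.mod_eq_of_lt h3] using this
    subst h4
    have h5 : i = i' := Nat.eq_of_mul_eq_mul_right (by omega : 0 < B) (by omega)
    subst h5
    rfl
  · intro p
    rw [Module.End.hasEigenvector_iff, Module.End.mem_eigenspace_iff]
    exact ⟨hf p, mul_ne_zero (pow_ne_zero _ hx) (pow_ne_zero _ hy)⟩

section GenericMatrices

open Polynomial

/-! ### Nonsingular matrix polynomials -/

section Determinant

variable {ι : Type*} [Fintype ι] [DecidableEq ι]

/-- A matrix of polynomials is nonsingular if all its nonzero matrix coefficients are. -/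
theorem det_matPolyEquiv_symm_ne_zero {R : Type*} [CommRing R] [IsDomain R]
    (p : (Matrix ι ι R)[X]) (hp : p ≠ 0) (h : ∀ k, p.coeff k ≠ 0 → (p.coeff k).det ≠ 0) :
    (matPolyEquiv.symm p).det ≠ 0 := by
  obtain ⟨d, hd⟩ : ∃ d, p.natDegree ≤ d := ⟨_, le_rfl⟩
  induction d generalizing p with
  | zero =>
    have h1 := Polynomial.eq_C_of_natDegree_le_zero hd
    rw [h1] at hp ⊢
    have h2 : p.coeff 0 ≠ 0 := fun h0 => hp (by rw [h0, C_0])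
    rw [matPolyEquiv_symm_C]
    have h3 := RingHom.map_det (C : R →+* R[X]) (p.coeff 0)
    rw [RingHom.mapMatrix_apply] at h3
    rw [← h3]
    exact C_ne_zero.2 (h 0 h2)
  | succ d ih =>
    by_cases h0 : p.coeff 0 = 0
    -- Powers of `X` are split off until the constant coefficient is nonzero; the determinant at `0`
    -- is then that of this coefficient.
    · have h1 : p = X * p.divX := by
        conv_lhs => rw [← Polynomial.X_mul_divX_add p]
        rw [h0, C_0, add_zero]
      have hq : p.divX ≠ 0 := by
        intro hq
        rw [hq, mul_zero] at h1
        exact hp h1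
      have h2 := ih p.divX hq (fun k hk => by
        rw [coeff_divX] at hk ⊢
        exact h _ hk) (by rw [natDegree_divX_eq_natDegree_tsub_one]; omega)
      rw [h1, map_mul, Matrix.det_mul]
      refine mul_ne_zero ?_ h2
      rw [matPolyEquiv_symm_X, Matrix.det_diagonal]
      exact Finset.prod_ne_zero_iff.2 fun _ _ => X_ne_zero
    · intro hdet
      have h1 := eval_det (matPolyEquiv.symm p) 0
      rw [hdet, eval_zero] at h1
      rw [AlgEquiv.apply_symm_apply] at h1
      refine h 0 h0 ?_
      rw [Matrix.scalar_apply, Matrix.diagonal_zero, ← coeff_zero_eq_eval_zero] at h1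
      exact h1.symm

end Determinant

/-! ### Freeness from degeneration to rank one -/

section Reduction

variable {ι R S L : Type*} [CommRing R] [CommRing S] [CommRing L]
  [Algebra R L]

/-- The matrix `g` becomes integral over `R` after scaling by an element with image `s₀` under
`ev : R →+* S`, and then has image `N`. -/
def ReducesTo (ev : R →+* S) (g : Matrix ι ι L) (s₀ : S) (N : Matrix ι ι S) : Prop :=
  ∃ (s : R) (M : Matrix ι ι R), algebraMap R L s • g = M.map (algebraMap R L) ∧ ev s = s₀ ∧
    M.map ev = N

variable {ev : R →+* S}

theorem ReducesTo.mul [Fintype ι] {g g' : Matrix ι ι L} {s s' : S} {N N' : Matrix ι ι S}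
    (h : ReducesTo ev g s N) (h' : ReducesTo ev g' s' N') :
    ReducesTo ev (g * g') (s * s') (N * N') := by
  obtain ⟨r, M, h1, rfl, rfl⟩ := h
  obtain ⟨r', M', h1', rfl, rfl⟩ := h'
  refine ⟨r * r', M * M', ?_, map_mul _ _ _, Matrix.map_mul⟩
  rw [Matrix.map_mul, ← h1, ← h1', map_mul, smul_mul_smul_comm]

theorem ReducesTo.of_map (M : Matrix ι ι R) :
    ReducesTo ev (M.map (algebraMap R L)) 1 (M.map ev) :=
  ⟨1, M, by rw [map_one, one_smul], map_one _, rfl⟩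

/-- Faithfulness makes the scaled identity scalar already over `R`. For `s = 0`, the identity can
only reduce to zero, which is how nontrivial words are detected. -/
theorem ReducesTo.eq_smul_one [DecidableEq ι] [FaithfulSMul R L] {s : S} {N : Matrix ι ι S}
    (h : ReducesTo ev (1 : Matrix ι ι L) s N) : N = s • (1 : Matrix ι ι S) := by
  obtain ⟨r, M, h1, rfl, rfl⟩ := h
  have h2 : M = r • (1 : Matrix ι ι R) := by
    apply Matrix.map_injective (FaithfulSMul.algebraMap_injective R L)
    beta_reduce
    rw [← h1]
    ext i j
    by_cases hij : i = j <;> simp [hij]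
  rw [h2]
  ext i j
  by_cases hij : i = j <;> simp [hij]

theorem ReducesTo.inv [Fintype ι] [DecidableEq ι] {u : (Matrix ι ι L)ˣ} {A B : Matrix ι ι R} {s : R}
    (hu : (u : Matrix ι ι L) = A.map (algebraMap R L)) (hAB : A * B = s • (1 : Matrix ι ι R)) :
    ReducesTo ev ((u⁻¹ : (Matrix ι ι L)ˣ) : Matrix ι ι L) (ev s) (B.map ev) := by
  refine ⟨s, B, ?_, rfl, rfl⟩
  have h1 : (u : Matrix ι ι L) * B.map (algebraMap R L) = algebraMap R L s • 1 := by
    rw [hu, ← Matrix.map_mul, hAB]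
    ext i j
    by_cases hij : i = j <;> simp [hij]
  calc algebraMap R L s • ((u⁻¹ : (Matrix ι ι L)ˣ) : Matrix ι ι L)
      = ((u⁻¹ : (Matrix ι ι L)ˣ) : Matrix ι ι L) * (algebraMap R L s • 1) := by
        rw [mul_smul_comm, mul_one]
    _ = B.map (algebraMap R L) := by rw [← h1, Units.inv_mul_cancel_left]

/-- A freeness criterion: all letters reduce to matrices of rank one, and the products of the
reductions of two consecutive letters of a reduced word do not vanish. -/
theorem FreeGroup.lift_injective_of_reducesTo [Fintype ι] [DecidableEq ι] [FaithfulSMul R L] [IsDomain S] {α : Type*}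
    (g : α → (Matrix ι ι L)ˣ) (A B : α × Bool → Matrix ι ι S) (a : α × Bool → ι) (k : α × Bool → S)
    (hk : ∀ l, k l ≠ 0)
    (hred : ∀ l : α × Bool, ReducesTo ev
      ((cond l.2 (g l.1) (g l.1)⁻¹ : (Matrix ι ι L)ˣ) : Matrix ι ι L) 0
      (A l * Matrix.single (a l) (a l) (k l) * B l))
    (hpair : ∀ l l' : α × Bool, (l.1 = l'.1 → l.2 = l'.2) → (B l * A l') (a l) (a l') ≠ 0) :
    Function.Injective (FreeGroup.lift g) := by
  classical
  have key : ∀ (t : List (α × Bool)) (h : α × Bool), FreeGroup.IsReduced (h :: t) →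
      ∃ (e : α × Bool) (c : S), c ≠ 0 ∧ ReducesTo ev
        ((((h :: t).map fun l => cond l.2 (g l.1) (g l.1)⁻¹).prod : (Matrix ι ι L)ˣ) :
          Matrix ι ι L) 0 (A h * Matrix.single (a h) (a e) c * B e) := by
    intro t
    induction t with
    | nil =>
      intro h _
      refine ⟨h, k h, hk h, ?_⟩
      simpa using hred h
    | cons h' t ih =>
      intro h hr
      rw [FreeGroup.IsReduced, List.isChain_cons_cons] at hr
      obtain ⟨e, c, hc, hc'⟩ := ih h' hr.2
      refine ⟨e, k h * (B h * A h') (a h) (a h') * c,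
        mul_ne_zero (mul_ne_zero (hk h) (hpair h h' hr.1)) hc, ?_⟩
      rw [List.map_cons, List.prod_cons, Units.val_mul, ← Matrix.single_mul_mul_single]
      have := (hred h).mul hc'
      rw [zero_mul] at this
      convert this using 1
      simp only [mul_assoc]
  rw [injective_iff_map_eq_one]
  intro w hw
  by_contra hne
  have hnil : w.toWord ≠ [] := fun h => hne (FreeGroup.toWord_eq_nil_iff.1 h)
  obtain ⟨h, t, ht⟩ := List.exists_cons_of_ne_nil hnil
  obtain ⟨e, c, hc, hred'⟩ := key t h (ht ▸ FreeGroup.isReduced_toWord)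
  rw [← FreeGroup.mk_toWord (x := w), FreeGroup.lift_mk, ht] at hw
  rw [hw, Units.val_one] at hred'
  have h0 := hred'.eq_smul_one
  rw [zero_smul] at h0
  -- Multiplying the vanishing reduction by `B h` and `A e` isolates one entry, a product of factors
  -- nonzero by `hpair` for equal letters.
  have h1 : Matrix.single (a h) (a h) 1 * (B h * A h) * Matrix.single (a h) (a e) c *
      (B e * A e) * Matrix.single (a e) (a e) 1 = 0 := by
    calc _ = Matrix.single (a h) (a h) 1 * B h * (A h * Matrix.single (a h) (a e) c * B e) *
          A e * Matrix.single (a e) (a e) 1 := by simp only [mul_assoc]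
      _ = 0 := by rw [h0]; simp
  rw [Matrix.single_mul_mul_single, Matrix.single_mul_mul_single] at h1
  have h2 := congrFun (congrFun h1 (a h)) (a e)
  rw [Matrix.single_apply_same, Matrix.zero_apply, one_mul, mul_one] at h2
  exact mul_ne_zero (mul_ne_zero (hpair h h fun _ => rfl) hc) (hpair e e fun _ => rfl) h2

end Reduction

/-! ### Generic clock and shift matrices at a root of unity -/

section ClockShift

variable {F : Type*} [Field F] {n : ℕ} [NeZero n]

/-- The diagonal matrix of the powers of `ζ`. -/
def clockMatrix (ζ : F) (n : ℕ) : Matrix (ZMod n) (ZMod n) F :=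
  Matrix.diagonal fun m => ζ ^ m.val

/-- The matrix of the cyclic shift. -/
def shiftMatrix (F : Type*) [Field F] (n : ℕ) : Matrix (ZMod n) (ZMod n) F :=
  Matrix.of fun i j => if i = j + 1 then 1 else 0

theorem pow_val_add_one {ζ : F} (hζ : ζ ^ n = 1) (m : ZMod n) :
    ζ ^ (m + 1).val = ζ * ζ ^ m.val := by
  have h1 : ∀ k : ℕ, ζ ^ (k : ZMod n).val = ζ ^ k := by
    intro k
    rw [ZMod.val_natCast]
    conv_rhs => rw [← Nat.mod_add_div k n, pow_add, pow_mul, hζ, one_pow, mul_one]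
  have h2 := h1 (m.val + 1)
  rw [Nat.cast_add, ZMod.natCast_zmod_val, Nat.cast_one] at h2
  rw [h2, pow_succ']

theorem shiftMatrix_pow_apply (k : ℕ) (i j : ZMod n) :
    (shiftMatrix F n ^ k) i j = if i = j + k then 1 else 0 := by
  induction k generalizing i j with
  | zero => simp [Matrix.one_apply]
  | succ k ih =>
    rw [pow_succ, Matrix.mul_apply]
    have h1 : ∀ m j : ZMod n, shiftMatrix F n m j = if m = j + 1 then 1 else 0 := fun _ _ => rfl
    simp only [ih, h1, mul_ite, mul_one, mul_zero, Finset.sum_ite_eq', Finset.mem_univ, if_true]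
    rw [Nat.cast_add, Nat.cast_one, add_assoc, add_comm (1 : ZMod n)]

theorem shiftMatrix_pow_self : shiftMatrix F n ^ n = 1 := by
  ext i j
  rw [shiftMatrix_pow_apply]
  simp [Matrix.one_apply]

theorem clockMatrix_pow_self {ζ : F} (hζ : ζ ^ n = 1) : clockMatrix ζ n ^ n = 1 := by
  rw [clockMatrix, Matrix.diagonal_pow]
  ext i j
  by_cases hij : i = j
  · subst hij
    simp only [Matrix.diagonal_apply_eq, Pi.pow_apply, Matrix.one_apply_eq]
    rw [← pow_mul, mul_comm, pow_mul, hζ, one_pow]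
  · simp [hij]

theorem det_clockMatrix_pow_mul_shiftMatrix_pow_ne_zero {ζ : F} (hζ : ζ ^ n = 1) (i j : ℕ) :
    (clockMatrix ζ n ^ i * shiftMatrix F n ^ j).det ≠ 0 := by
  have h1 : (clockMatrix ζ n).det ≠ 0 := fun h => by
    have := congrArg Matrix.det (clockMatrix_pow_self hζ)
    rw [Matrix.det_pow, h, zero_pow (NeZero.ne n), Matrix.det_one] at this
    exact zero_ne_one this
  have h2 : (shiftMatrix F n).det ≠ 0 := fun h => by
    have := congrArg Matrix.det (shiftMatrix_pow_self (F := F) (n := n))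
    rw [Matrix.det_pow, h, zero_pow (NeZero.ne n), Matrix.det_one] at this
    exact zero_ne_one this
  rw [Matrix.det_mul, Matrix.det_pow, Matrix.det_pow]
  exact mul_ne_zero (pow_ne_zero _ h1) (pow_ne_zero _ h2)

/-- The clock matrix times the outer variable of `F[X][X]`. -/
noncomputable def genericClock (ζ : F) (n : ℕ) : Matrix (ZMod n) (ZMod n) F[X][X] :=
  (X : F[X][X]) • ((clockMatrix ζ n).map C).map C

/-- The shift matrix times the variable of `F[X]`. -/
noncomputable def scaledShift (F : Type*) [Field F] (n : ℕ) : Matrix (ZMod n) (ZMod n) F[X] :=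
  (X : F[X]) • (shiftMatrix F n).map C

/-- The shift matrix times the inner variable of `F[X][X]`. -/
noncomputable def genericShift (F : Type*) [Field F] (n : ℕ) : Matrix (ZMod n) (ZMod n) F[X][X] :=
  (scaledShift F n).map C

theorem genericClock_eq_diagonal (ζ : F) (n : ℕ) :
    genericClock ζ n = Matrix.diagonal fun m => X * C (C (ζ ^ m.val)) := by
  ext1 i j
  by_cases hij : i = j <;> simp [genericClock, clockMatrix, hij]

theorem genericClock_mul_genericShift {ζ : F} (hζ : ζ ^ n = 1) :
    genericClock ζ n * genericShift F n = ζ • (genericShift F n * genericClock ζ n) := by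
  ext1 i j
  rw [genericClock_eq_diagonal, Matrix.diagonal_mul, Matrix.smul_apply, Matrix.mul_diagonal]
  simp only [genericShift, scaledShift, shiftMatrix, Matrix.map_apply, Matrix.smul_apply,
    Matrix.of_apply]
  by_cases h : i = j + 1
  · rw [if_pos h, h, pow_val_add_one hζ, ← algebraMap_smul F[X][X] ζ]
    simp only [map_mul, smul_eq_mul, map_one, mul_one, Polynomial.algebraMap_apply]
    simp only [Algebra.algebraMap_self, RingHom.id_apply]
    ring
  · rw [if_neg h]; simp

theorem matPolyEquiv_generic_monom (ζ : F) (p : ℕ × ℕ) :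
    matPolyEquiv (monom (genericClock ζ n) (genericShift F n) p) =
      monomial p.1 (matPolyEquiv.symm
        (monomial p.2 (clockMatrix ζ n ^ p.1 * shiftMatrix F n ^ p.2))) := by
  have h1 : matPolyEquiv (genericClock ζ n) = C ((clockMatrix ζ n).map C) * X := by
    rw [genericClock, matPolyEquiv_map_smul, Polynomial.map_X, matPolyEquiv_map_C, X_mul]
  have h2 : matPolyEquiv (genericShift F n) = C (scaledShift F n) := by
    rw [genericShift, matPolyEquiv_map_C]
  have h3 : matPolyEquiv (scaledShift F n) = C (shiftMatrix F n) * X := by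
    rw [scaledShift, matPolyEquiv_map_smul, Polynomial.map_X, matPolyEquiv_map_C, X_mul]
  have h4 : (clockMatrix ζ n).map C ^ p.1 * scaledShift F n ^ p.2 = matPolyEquiv.symm
      (monomial p.2 (clockMatrix ζ n ^ p.1 * shiftMatrix F n ^ p.2)) := by
    apply matPolyEquiv.injective
    rw [AlgEquiv.apply_symm_apply, map_mul, map_pow, map_pow, h3, matPolyEquiv_map_C,
      ((commute_X (C (shiftMatrix F n))).symm).mul_pow, ← C_pow, ← C_pow, ← mul_assoc, ← C_mul,
      C_mul_X_pow_eq_monomial]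
  rw [← h4, monom, map_mul, map_pow, map_pow, h1, h2,
    ((commute_X (C ((clockMatrix ζ n).map C))).symm).mul_pow, ← C_pow, ← C_pow, mul_assoc, X_pow_mul,
    ← mul_assoc, ← C_mul, C_mul_X_pow_eq_monomial]

/-- The two variables separate the monomials: each bihomogeneous coefficient is a scalar times an
invertible product of clock and shift powers. The determinant criterion is applied once per
variable. -/
theorem det_linearCombination_monom_ne_zero {ζ : F} (hζ : ζ ^ n = 1) (c : ℕ × ℕ →₀ F)
    (hc : c ≠ 0) :
    (Finsupp.linearCombination F (monom (genericClock ζ n) (genericShift F n)) c).det ≠ 0 := by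
  classical
  have hcoeff : ∀ (c : ℕ × ℕ →₀ F) (i j), (matPolyEquiv ((matPolyEquiv (Finsupp.linearCombination F
      (monom (genericClock ζ n) (genericShift F n)) c)).coeff i)).coeff j =
        c (i, j) • (clockMatrix ζ n ^ i * shiftMatrix F n ^ j) := by
    intro c i j
    induction c using Finsupp.induction_linear with
    | zero => simp
    | add c c' h h' =>
      rw [map_add, map_add, coeff_add, map_add, coeff_add, h, h', Finsupp.add_apply, add_smul]
    | single p a =>
      rw [Finsupp.linearCombination_single, ← algebraMap_smul F[X] a, map_smul, coeff_smul,
        matPolyEquiv_generic_monom, coeff_monomial]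
      split_ifs with h
      · rw [algebraMap_smul, map_smul, AlgEquiv.apply_symm_apply, coeff_smul, coeff_monomial]
        split_ifs with h'
        · subst h h'
          simp
        · rw [Finsupp.single_apply, if_neg (fun h'' => h' (congrArg Prod.snd h'')), smul_zero,
            zero_smul]
      · rw [Finsupp.single_apply, if_neg (fun h'' => h (congrArg Prod.fst h'')), smul_zero,
          map_zero, coeff_zero, zero_smul]
  rw [← AlgEquiv.symm_apply_apply matPolyEquiv (Finsupp.linearCombination F
      (monom (genericClock ζ n) (genericShift F n)) c)]
  refine det_matPolyEquiv_symm_ne_zero _ (fun h0 => hc ?_) fun i hi => ?_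
  · ext ⟨i, j⟩
    have h1 := hcoeff c i j
    rw [h0, coeff_zero, map_zero, coeff_zero] at h1
    by_contra hne
    refine det_clockMatrix_pow_mul_shiftMatrix_pow_ne_zero (F := F) (n := n) hζ i j ?_
    rw [(smul_eq_zero.1 h1.symm).resolve_left hne, Matrix.det_zero]
  · rw [← AlgEquiv.symm_apply_apply matPolyEquiv
      ((matPolyEquiv (Finsupp.linearCombination F _ c)).coeff i)]
    refine det_matPolyEquiv_symm_ne_zero _ (fun h0 => hi ?_) fun j hj => ?_
    · simpa using h0
    · rw [hcoeff] at hj ⊢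
      rw [Matrix.det_smul]
      exact mul_ne_zero (pow_ne_zero _ fun h => hj (by rw [h, zero_smul]))
        (det_clockMatrix_pow_mul_shiftMatrix_pow_ne_zero hζ i j)

theorem pow_val_injective {ζ : F} (hζ : IsPrimitiveRoot ζ n) :
    Function.Injective fun m : ZMod n => ζ ^ m.val := fun a b h =>
  ZMod.val_injective n (hζ.pow_inj (ZMod.val_lt a) (ZMod.val_lt b) h)

/-- The matrix `1 - α • genericClock ζ n`. -/
noncomputable def clockFactor (ζ : F) (n : ℕ) (α : F) : Matrix (ZMod n) (ZMod n) F[X][X] :=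
  Matrix.diagonal fun m => 1 - X * C (C (α * ζ ^ m.val))

theorem clockFactor_eq (ζ : F) (n : ℕ) (α : F) :
    clockFactor ζ n α = 1 - α • genericClock ζ n := by
  ext1 i j
  rw [genericClock_eq_diagonal, clockFactor]
  by_cases hij : i = j
  · subst hij
    rw [Matrix.sub_apply, Matrix.smul_apply, Matrix.diagonal_apply_eq, Matrix.diagonal_apply_eq,
      Matrix.one_apply_eq, ← algebraMap_smul F[X][X] α]
    simp only [map_mul, smul_eq_mul, Polynomial.algebraMap_apply, Algebra.algebraMap_self,
      RingHom.id_apply]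
    ring
  · simp [hij]

variable {L : Type*} [CommRing L] [Algebra F[X][X] L]

/-- Each `β * ζ ^ m` is an `n`-th root of unity, so geometric sums invert the denominator up to the
factor `1 - X ^ n`. At `X = 1` such a sum is `n` where `β * ζ ^ m = 1` and zero elsewhere, so one
diagonal entry survives. -/
theorem reducesTo_clockFactor_div {ζ α β : F} (hζ : IsPrimitiveRoot ζ n) (hβ : β ^ n = 1)
    {m₀ : ZMod n} (hm : ∀ m : ZMod n, β * ζ ^ m.val = 1 ↔ m = m₀)
    {u u' : (Matrix (ZMod n) (ZMod n) L)ˣ}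
    (hu : (u : Matrix (ZMod n) (ZMod n) L) = (clockFactor ζ n α).map (algebraMap F[X][X] L))
    (hu' : (u' : Matrix (ZMod n) (ZMod n) L) = (clockFactor ζ n β).map (algebraMap F[X][X] L)) :
    ReducesTo (evalRingHom (1 : F[X])) ((u * u'⁻¹ : (Matrix (ZMod n) (ZMod n) L)ˣ) : Matrix _ _ L) 0
      (Matrix.single m₀ m₀ (C ((1 - α * ζ ^ m₀.val) * n))) := by
  have hpow : ∀ m : ZMod n, (β * ζ ^ m.val) ^ n = 1 := fun m => by
    rw [mul_pow, hβ, one_mul, ← pow_mul, mul_comm, pow_mul, hζ.pow_eq_one, one_pow]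
  have h1 : clockFactor ζ n β * Matrix.diagonal (fun m : ZMod n =>
      ∑ k ∈ Finset.range n, ((X : F[X][X]) * C (C (β * ζ ^ m.val))) ^ k) =
      (1 - X ^ n : F[X][X]) • (1 : Matrix (ZMod n) (ZMod n) F[X][X]) := by
    rw [clockFactor, Matrix.diagonal_mul_diagonal]
    ext1 i j
    rw [Matrix.smul_apply]
    by_cases hij : i = j
    · subst hij
      rw [Matrix.diagonal_apply_eq, Matrix.one_apply_eq, mul_neg_geom_sum, mul_pow, ← C_pow,
        ← C_pow, hpow, C_1, C_1, mul_one, smul_eq_mul, mul_one]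
    · rw [Matrix.diagonal_apply_ne _ hij, Matrix.one_apply_ne hij, smul_zero]
  have h2 := (ReducesTo.of_map (L := L) (ev := evalRingHom (1 : F[X])) (clockFactor ζ n α)).mul
    (ReducesTo.inv (ev := evalRingHom (1 : F[X])) hu' h1)
  rw [← hu, ← Units.val_mul] at h2
  convert h2 using 1
  · simp
  · rw [clockFactor, Matrix.diagonal_map (map_zero _), Matrix.diagonal_map (map_zero _),
      Matrix.diagonal_mul_diagonal]
    ext1 i j
    by_cases hij : i = j
    · subst hij
      rw [Matrix.diagonal_apply_eq]
      simp only [coe_evalRingHom, eval_sub, eval_one, eval_mul, eval_X, eval_C, one_mul,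
        eval_finsetSum, eval_pow]
      by_cases him : i = m₀
      · subst him
        rw [Matrix.single_apply_same, (hm i).2 rfl]
        simp
      · rw [Matrix.single_apply_of_row_ne (Ne.symm him)]
        have hne : β * ζ ^ i.val ≠ 1 := fun h => him ((hm i).1 h)
        have hsum : ∑ k ∈ Finset.range n, (β * ζ ^ i.val) ^ k = 0 := by
          have := mul_neg_geom_sum (β * ζ ^ i.val) n
          rw [hpow, sub_self] at this
          exact (mul_eq_zero.1 this).resolve_left (sub_ne_zero.2 hne.symm)
        have : ∑ k ∈ Finset.range n, (C (β * ζ ^ i.val)) ^ k = 0 := by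
          rw [← C_0, ← hsum, map_sum]
          simp only [C_pow]
        rw [this, mul_zero]
    · rw [Matrix.diagonal_apply_ne _ hij]
      by_cases him : i = m₀
      · subst him
        exact Matrix.single_apply_of_ne _ _ _ _ _ (fun h => hij h.2)
      · rw [Matrix.single_apply_of_row_ne (Ne.symm him)]

/-- The square of `1 - scaledShift F n`. -/
noncomputable def shiftSq (F : Type*) [Field F] (n : ℕ) [NeZero n] :
    Matrix (ZMod n) (ZMod n) F[X] :=
  (1 - scaledShift F n) ^ 2

/-- A scalar multiple of the inverse of `shiftSq F n`. -/
noncomputable def shiftSqCofactor (F : Type*) [Field F] (n : ℕ) [NeZero n] :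
    Matrix (ZMod n) (ZMod n) F[X] :=
  (∑ k ∈ Finset.range n, scaledShift F n ^ k) ^ 2

theorem scaledShift_pow_self : scaledShift F n ^ n = (X ^ n : F[X]) • 1 := by
  have h1 := RingHom.map_pow (C : F →+* F[X]).mapMatrix (shiftMatrix F n) n
  rw [shiftMatrix_pow_self, map_one, RingHom.mapMatrix_apply] at h1
  rw [scaledShift, _root_.smul_pow, ← h1]

theorem commute_geom_sum_scaledShift :
    Commute (1 - scaledShift F n) (∑ k ∈ Finset.range n, scaledShift F n ^ k) :=
  Commute.sum_right _ _ _ fun k _ =>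
    ((Commute.one_left _).sub_left (Commute.refl _)).pow_right k

theorem shiftSq_mul_shiftSqCofactor :
    shiftSq F n * shiftSqCofactor F n = ((1 - X ^ n) ^ 2 : F[X]) • 1 := by
  rw [shiftSq, shiftSqCofactor, ← commute_geom_sum_scaledShift.mul_pow, mul_neg_geom_sum,
    scaledShift_pow_self]
  conv_lhs => rw [← one_smul F[X] (1 : Matrix (ZMod n) (ZMod n) F[X]), smul_smul, mul_one,
    ← sub_smul]
  rw [_root_.smul_pow, one_pow]

theorem shiftSqCofactor_mul_shiftSq :
    shiftSqCofactor F n * shiftSq F n = ((1 - X ^ n) ^ 2 : F[X]) • 1 := by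
  rw [← shiftSq_mul_shiftSqCofactor, shiftSq, shiftSqCofactor]
  exact (commute_geom_sum_scaledShift.pow_pow 2 2).eq.symm

theorem eval_one_scaledShift :
    (evalRingHom (1 : F)).mapMatrix (scaledShift F n) = shiftMatrix F n := by
  ext i j
  simp [scaledShift]

theorem eval_one_shiftSq_apply (i j : ZMod n) : (shiftSq F n i j).eval 1 =
    (if i = j then 1 else 0) - 2 * (if i = j + 1 then 1 else 0) + if i = j + 2 then 1 else 0 := by
  have h1 : (evalRingHom (1 : F)).mapMatrix (shiftSq F n) =
      1 - (2 : F) • shiftMatrix F n ^ 1 + shiftMatrix F n ^ 2 := by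
    rw [shiftSq, map_pow, map_sub, map_one, eval_one_scaledShift, two_smul]
    noncomm_ring
  have h2 := congrFun (congrFun h1 i) j
  rw [Matrix.add_apply, Matrix.sub_apply, Matrix.smul_apply, shiftMatrix_pow_apply,
    shiftMatrix_pow_apply, Matrix.one_apply] at h2
  simpa using h2

theorem eval_one_shiftSqCofactor_apply (i j : ZMod n) :
    (shiftSqCofactor F n i j).eval 1 = n := by
  have hJ : ∑ k ∈ Finset.range n, shiftMatrix F n ^ k = Matrix.of fun _ _ => 1 := by
    ext i j
    rw [Matrix.sum_apply, Matrix.of_apply, Finset.sum_eq_single (i - j).val]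
    · rw [shiftMatrix_pow_apply, if_pos]
      simp
    · intro k hk hne
      rw [shiftMatrix_pow_apply, if_neg]
      rintro rfl
      apply hne
      rw [add_sub_cancel_left, ZMod.val_natCast, Nat.mod_eq_of_lt (Finset.mem_range.1 hk)]
    · intro h
      exact absurd (Finset.mem_range.2 (ZMod.val_lt _)) h
  have h1 : (evalRingHom (1 : F)).mapMatrix (shiftSqCofactor F n) = Matrix.of fun _ _ => (n : F) := by
    rw [shiftSqCofactor, map_pow, map_sum]
    simp only [map_pow, eval_one_scaledShift]
    rw [hJ, pow_two]
    ext i j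
    simp [Matrix.mul_apply]
  exact congrFun (congrFun h1 i) j

/-- Freeness of the specialized elements. -/
theorem lift_injective_generic [FaithfulSMul F[X][X] L] {ζ κ₀ : F} (hζ : IsPrimitiveRoot ζ n)
    (hn : 3 ≤ n) (h2 : (2 : F) ≠ 0) (hκ₀ : κ₀ ≠ 0)
    {u₁ u₂ u₃ v κ : (Matrix (ZMod n) (ZMod n) L)ˣ}
    (hu₁ : (u₁ : Matrix (ZMod n) (ZMod n) L) = (clockFactor ζ n ζ⁻¹).map (algebraMap F[X][X] L))
    (hu₂ : (u₂ : Matrix (ZMod n) (ZMod n) L) = (clockFactor ζ n 1).map (algebraMap F[X][X] L))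
    (hu₃ : (u₃ : Matrix (ZMod n) (ZMod n) L) = (clockFactor ζ n ζ).map (algebraMap F[X][X] L))
    (hv : (v : Matrix (ZMod n) (ZMod n) L) = (1 - genericShift F n).map (algebraMap F[X][X] L))
    (hκ : (κ : Matrix (ZMod n) (ZMod n) L) =
      (C (C κ₀) • (1 : Matrix (ZMod n) (ZMod n) F[X][X])).map (algebraMap F[X][X] L)) :
    Function.Injective (FreeGroup.lift fun b : Bool =>
      cond b (u₁ * u₂⁻¹) (v ^ 2 * (κ * (u₃ * u₂⁻¹)) * (v ^ 2)⁻¹)) := by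
  have hζ0 : ζ ≠ 0 := hζ.ne_zero (NeZero.ne n)
  have hζ1 : ζ ≠ 1 := hζ.ne_one (by omega)
  have hn0 : (n : F) ≠ 0 := by
    have := hζ.neZero'
    exact NeZero.ne _
  have hinj := pow_val_injective hζ
  have hχ0 : ζ ^ (0 : ZMod n).val = 1 := by simp
  have hχ1 : ζ ^ (1 : ZMod n).val = ζ := by
    have := pow_val_add_one hζ.pow_eq_one (0 : ZMod n)
    rwa [zero_add, hχ0, mul_one] at this
  have hχn : ζ ^ (-1 : ZMod n).val = ζ⁻¹ := by
    have := pow_val_add_one hζ.pow_eq_one (-1 : ZMod n)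
    rw [neg_add_cancel, hχ0] at this
    exact eq_inv_of_mul_eq_one_right this.symm
  have hm1 : ∀ m : ZMod n, 1 * ζ ^ m.val = 1 ↔ m = 0 := fun m => by
    rw [one_mul]
    exact ⟨fun h => hinj (h.trans hχ0.symm), fun h => by rw [h, hχ0]⟩
  have hmi : ∀ m : ZMod n, ζ⁻¹ * ζ ^ m.val = 1 ↔ m = 1 := fun m => by
    rw [inv_mul_eq_one₀ hζ0]
    exact ⟨fun h => hinj (h.symm.trans hχ1.symm), fun h => by rw [h, hχ1]⟩
  have hmz : ∀ m : ZMod n, ζ * ζ ^ m.val = 1 ↔ m = -1 := fun m => by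
    rw [mul_eq_one_iff_inv_eq₀ hζ0]
    exact ⟨fun h => hinj (h.symm.trans hχn.symm), fun h => by rw [h, hχn]⟩
  have hzi1 : ζ⁻¹ ≠ 1 := inv_ne_one.2 hζ1
  have hw := reducesTo_clockFactor_div hζ (one_pow n) hm1 hu₁ hu₂
  have hwi := reducesTo_clockFactor_div hζ (by rw [inv_pow, hζ.pow_eq_one, inv_one]) hmi hu₂ hu₁
  have hW := reducesTo_clockFactor_div hζ (one_pow n) hm1 hu₃ hu₂
  have hWi := reducesTo_clockFactor_div hζ hζ.pow_eq_one hmz hu₂ hu₃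
  rw [hχ0, mul_one] at hw hW
  rw [hχ1, one_mul] at hwi
  rw [hχn, one_mul] at hWi
  have hk : ReducesTo (evalRingHom (1 : F[X])) (κ : Matrix (ZMod n) (ZMod n) L) 1
      (C κ₀ • (1 : Matrix (ZMod n) (ZMod n) F[X])) := by
    rw [hκ]
    convert ReducesTo.of_map (L := L) (ev := evalRingHom (1 : F[X])) _ using 1
    ext1 i j
    by_cases hij : i = j <;> simp [hij]
  have hki : ReducesTo (evalRingHom (1 : F[X]))
      ((κ⁻¹ : (Matrix (ZMod n) (ZMod n) L)ˣ) : Matrix (ZMod n) (ZMod n) L) 1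
      (C κ₀⁻¹ • (1 : Matrix (ZMod n) (ZMod n) F[X])) := by
    have := ReducesTo.inv (ev := evalRingHom (1 : F[X])) (s := 1)
      (B := C (C κ₀⁻¹) • (1 : Matrix (ZMod n) (ZMod n) F[X][X])) hκ (by
        rw [smul_mul_smul_comm, ← C_mul, ← C_mul, mul_inv_cancel₀ hκ₀, mul_one]
        simp)
    convert this using 1
    · simp
    · ext1 i j
      by_cases hij : i = j <;> simp [hij]
  have hevC : ∀ A : Matrix (ZMod n) (ZMod n) F[X], (A.map C).map (evalRingHom (1 : F[X])) = A := by
    intro A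
    ext1 i j
    simp
  have hV0 : ((v ^ 2 : (Matrix (ZMod n) (ZMod n) L)ˣ) : Matrix (ZMod n) (ZMod n) L) =
      ((shiftSq F n).map C).map (algebraMap F[X][X] L) := by
    have e1 := RingHom.map_pow (algebraMap F[X][X] L).mapMatrix (1 - genericShift F n) 2
    have e2 := RingHom.map_pow (C : F[X] →+* F[X][X]).mapMatrix (1 - scaledShift F n) 2
    rw [map_sub, map_one] at e2
    rw [Units.val_pow_eq_pow_val, hv]
    refine e1.symm.trans ?_
    rw [shiftSq]
    change _ = (algebraMap F[X][X] L).mapMatrix (C.mapMatrix _)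
    rw [e2]
    rfl
  have hV : ReducesTo (evalRingHom (1 : F[X]))
      ((v ^ 2 : (Matrix (ZMod n) (ZMod n) L)ˣ) : Matrix (ZMod n) (ZMod n) L) 1 (shiftSq F n) := by
    have := ReducesTo.of_map (L := L) (ev := evalRingHom (1 : F[X])) ((shiftSq F n).map C)
    rwa [hevC, ← hV0] at this
  have hVi : ReducesTo (evalRingHom (1 : F[X]))
      (((v ^ 2)⁻¹ : (Matrix (ZMod n) (ZMod n) L)ˣ) : Matrix (ZMod n) (ZMod n) L) ((1 - X ^ n) ^ 2)
      (shiftSqCofactor F n) := by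
    have := ReducesTo.inv (ev := evalRingHom (1 : F[X])) (s := C ((1 - X ^ n) ^ 2))
      (B := (shiftSqCofactor F n).map C) hV0 (by
        rw [← Matrix.map_mul, shiftSq_mul_shiftSqCofactor]
        ext1 i j
        by_cases hij : i = j <;> simp [hij])
    rwa [hevC, coe_evalRingHom, eval_C] at this
  have hself : ∀ a : ZMod n, (shiftSqCofactor F n * shiftSq F n) a a ≠ 0 := by
    intro a
    rw [shiftSqCofactor_mul_shiftSq, Matrix.smul_apply, Matrix.one_apply_eq, smul_eq_mul, mul_one]
    refine pow_ne_zero 2 fun h => ?_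
    have := congrArg (eval 0) h
    simp [NeZero.ne n] at this
  have hco : ∀ a b : ZMod n, shiftSqCofactor F n a b ≠ 0 := by
    intro a b h
    have := eval_one_shiftSqCofactor_apply (F := F) a b
    rw [h, eval_zero] at this
    exact hn0 this.symm
  have h10 : (1 : ZMod n) ≠ 0 := by
    intro h
    have := (ZMod.natCast_eq_zero_iff 1 n).1 (by exact_mod_cast h)
    exact absurd (Nat.le_of_dvd one_pos this) (by omega)
  have h20 : (2 : ZMod n) ≠ 0 := by
    intro h
    have := (ZMod.natCast_eq_zero_iff 2 n).1 (by exact_mod_cast h)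
    exact absurd (Nat.le_of_dvd two_pos this) (by omega)
  -- At `1` these entries are `1`, `-2`, `1`. The three diagonals are distinct because `n ≥ 3`, and
  -- `-2` is nonzero by `h2`.
  have hsq : ∀ a b : ZMod n, (a = b ∨ a = b + 1 ∨ a = b + 2) → shiftSq F n a b ≠ 0 := by
    intro a b hab h
    have h1 := eval_one_shiftSq_apply (F := F) a b
    have h12 : (1 : ZMod n) ≠ 2 := fun h => h10 (by
      have e : (2 : ZMod n) = 1 + 1 := by norm_num
      rw [e] at h
      exact (left_eq_add.1 h))
    rw [h, eval_zero] at h1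
    rcases hab with rfl | rfl | rfl
    · simp [h10, h20] at h1
    · simp [h10, h12, h2] at h1
    · simp [h20, h12.symm] at h1
  -- Only the outer variable is set to `1`. The surviving index is `0` for both generators, and `1`
  -- and `-1` for the inverses of the first and the second.
  refine FreeGroup.lift_injective_of_reducesTo (ev := evalRingHom (1 : F[X])) _
    (fun l => cond l.1 1 (shiftSq F n)) (fun l => cond l.1 1 (shiftSqCofactor F n))
    (fun l => cond l.2 0 (cond l.1 1 (-1)))
    (fun l => cond l.1 (cond l.2 (C ((1 - ζ⁻¹) * n)) (C ((1 - ζ) * n)))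
      (cond l.2 (C (κ₀ * ((1 - ζ) * n))) (C (κ₀⁻¹ * ((1 - ζ⁻¹) * n))))) ?_ ?_ ?_
  · have e1 := sub_ne_zero.2 hzi1.symm
    have e2 := sub_ne_zero.2 hζ1.symm
    have e3 := inv_ne_zero hκ₀
    rintro ⟨_ | _, _ | _⟩ <;> simp only [cond_true, cond_false, ne_eq, C_eq_zero] <;> positivity
  · rintro ⟨_ | _, _ | _⟩
    · have := (hV.mul (hWi.mul hki)).mul hVi
      simp only [← Units.val_mul, zero_mul, mul_zero] at this
      simp only [cond_false]
      convert this using 2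
      · rw [mul_inv_rev, mul_inv_rev, mul_inv_rev, mul_inv_rev, inv_inv, inv_inv]
        simp only [mul_assoc]
      · rw [mul_smul_comm, mul_one, Matrix.smul_single, smul_eq_mul, C_mul]
    · have := (hV.mul (hk.mul hW)).mul hVi
      simp only [← Units.val_mul, zero_mul, mul_zero] at this
      simp only [cond_true, cond_false]
      convert this using 3
      rw [smul_mul_assoc, one_mul, Matrix.smul_single, smul_eq_mul, C_mul]
    · simp only [cond_true, cond_false, one_mul, mul_one]
      convert hwi using 2
      rw [mul_inv_rev, inv_inv]
    · simp only [cond_true, one_mul, mul_one]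
      exact hw
  · rintro ⟨l, b⟩ ⟨l', b'⟩ h
    cases l <;> cases l'
    · obtain rfl : b = b' := h rfl
      exact hself _
    · simp only [cond_true, cond_false, mul_one]
      exact hco _ _
    · simp only [cond_true, cond_false, one_mul]
      -- Rows lie in `{0, 1}` and columns in `{0, -1}`, so the differences are `0`, `1`, `2`.
      apply hsq
      cases b <;> cases b' <;> simp only [cond_true, cond_false]
      · exact Or.inr (Or.inr (by ring))
      · exact Or.inr (Or.inl (by ring))
      · exact Or.inr (Or.inl (by ring))
      · exact Or.inl trivial
    · obtain rfl : b = b' := h rfl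
      simp only [cond_true, one_mul, Matrix.one_apply_eq]
      exact one_ne_zero

end ClockShift

/-- If a homomorphism from a free group lifts to a subgroup of a product in which the second
component is trivial whenever the first one is, then injectivity can be checked on the second
component. -/
theorem FreeGroup.lift_injective_of_prod {α A B : Type*} [Group A] [Group B] (Γ : Subgroup (A × B))
    (hΓ : ∀ g ∈ Γ, g.1 = 1 → g.2 = 1) (f : α → A) (f' : α → B) (hf : ∀ a, (f a, f' a) ∈ Γ)
    (hinj : Function.Injective (FreeGroup.lift f')) : Function.Injective (FreeGroup.lift f) := by
  rw [injective_iff_map_eq_one] at hinj ⊢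
  intro w hw
  apply hinj
  have hmem : ((FreeGroup.lift f).prod (FreeGroup.lift f')) w ∈ Γ := by
    have hle : (⊤ : Subgroup (FreeGroup α)) ≤
        Γ.comap ((FreeGroup.lift f).prod (FreeGroup.lift f')) := by
      rw [← FreeGroup.closure_range_of, Subgroup.closure_le]
      rintro _ ⟨a, rfl⟩
      simpa using hf a
    exact hle (Subgroup.mem_top w)
  exact hΓ _ hmem hw

/-! ### Invertibility over the fraction field and lifting freeness -/

section GenericUnits

variable {F : Type*} [Field F] {n : ℕ} [NeZero n]

theorem isUnit_linearCombination_generic_monom {ζ : F} (hζ : ζ ^ n = 1) (c : ℕ × ℕ →₀ F)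
    (hc : c ≠ 0) : IsUnit (Finsupp.linearCombination F
      (monom ((genericClock ζ n).map (algebraMap F[X][X] (FractionRing F[X][X])))
        ((genericShift F n).map (algebraMap F[X][X] (FractionRing F[X][X])))) c) := by
  let μ : Matrix (ZMod n) (ZMod n) F[X][X] →ₐ[F] Matrix (ZMod n) (ZMod n) (FractionRing F[X][X]) :=
    (IsScalarTower.toAlgHom F F[X][X] (FractionRing F[X][X])).mapMatrix
  have h1 : Finsupp.linearCombination F
      (monom ((genericClock ζ n).map (algebraMap F[X][X] (FractionRing F[X][X])))
        ((genericShift F n).map (algebraMap F[X][X] (FractionRing F[X][X])))) c =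
      μ (Finsupp.linearCombination F (monom (genericClock ζ n) (genericShift F n)) c) := by
    change _ = μ.toLinearMap _
    rw [Finsupp.apply_linearCombination]
    congr 2
    funext p
    rw [Function.comp_apply, AlgHom.toLinearMap_apply, monom, monom, map_mul, map_pow, map_pow]
    rfl
  rw [h1, Matrix.isUnit_iff_isUnit_det]
  have h2 : (μ (Finsupp.linearCombination F (monom (genericClock ζ n) (genericShift F n)) c)).det =
      algebraMap F[X][X] (FractionRing F[X][X])
        (Finsupp.linearCombination F (monom (genericClock ζ n) (genericShift F n)) c).det :=
    (RingHom.map_det (algebraMap F[X][X] (FractionRing F[X][X])) _).symm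
  rw [h2, isUnit_iff_ne_zero]
  intro h0
  exact det_linearCombination_monom_ne_zero hζ c hc
    ((map_eq_zero_iff _ (IsFractionRing.injective F[X][X] _)).1 h0)

theorem isUnit_one_sub_smul_monom {F M : Type*} [Field F] [Ring M] [Algebra F M] {x' y' : M}
    (hunit : ∀ c : ℕ × ℕ →₀ F, c ≠ 0 → IsUnit (Finsupp.linearCombination F (monom x' y') c))
    (α : F) {p : ℕ × ℕ} (hp : p ≠ (0, 0)) : IsUnit (1 - α • monom x' y' p) := by
  have h := hunit (Finsupp.single (0, 0) 1 - Finsupp.single p α) (fun h0 => by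
    have h1 := DFunLike.congr_fun h0 (0, 0)
    rw [Finsupp.sub_apply, Finsupp.single_eq_same, Finsupp.single_apply, if_neg hp] at h1
    simp at h1)
  rw [map_sub, Finsupp.linearCombination_single, Finsupp.linearCombination_single] at h
  simpa [monom] using h

end GenericUnits

/-- Two explicit free generators in a division algebra that contains `z`-commuting elements, where
`z` is a scalar of infinite order. -/
theorem lift_injective_of_qcomm {K E : Type*} [Field K] [DivisionRing E] [Algebra K E] {x y : E}
    {z : K} (hx : x ≠ 0) (hy : y ≠ 0) (hz0 : z ≠ 0) (hz : ∀ m : ℕ, 0 < m → z ^ m ≠ 1)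
    (h2 : (2 : K) ≠ 0) (hxy : x * y = z • (y * x)) (e : ℤ) {U₁ U₂ U₃ V κ : Eˣ}
    (hU₁ : (U₁ : E) = 1 - z⁻¹ • x) (hU₂ : (U₂ : E) = 1 - x) (hU₃ : (U₃ : E) = 1 - z • x)
    (hV : (V : E) = 1 - y) (hκ : (κ : E) = algebraMap K E (z ^ e)) :
    Function.Injective (FreeGroup.lift fun b : Bool =>
      cond b (U₁ * U₂⁻¹) (V ^ 2 * (κ * (U₃ * U₂⁻¹)) * (V ^ 2)⁻¹)) := by
  obtain ⟨O, t, n, ht, hn, hprim, h2F⟩ :=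
    exists_valuationSubring_residue_isPrimitiveRoot z hz0 hz h2
  have : NeZero n := ⟨by omega⟩
  let F := IsLocalRing.ResidueField O
  let ζ : F := IsLocalRing.residue O t
  have hζ0 : ζ ≠ 0 := hprim.ne_zero (NeZero.ne n)
  let L := FractionRing F[X][X]
  let M := Matrix (ZMod n) (ZMod n) L
  let _ : Algebra O E := ((algebraMap K E).comp O.subtype).toAlgebra' fun c a =>
    Algebra.commutes (c : K) a
  have : IsScalarTower O K E := IsScalarTower.of_algebraMap_eq fun _ => rfl
  let x' : M := (genericClock ζ n).map (algebraMap F[X][X] L)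
  let y' : M := (genericShift F n).map (algebraMap F[X][X] L)
  let μ : Matrix (ZMod n) (ZMod n) F[X][X] →ₐ[F] M := (IsScalarTower.toAlgHom F F[X][X] L).mapMatrix
  have hsmulE : ∀ (o : O) (a : E), o • a = (o : K) • a := fun o a => (algebraMap_smul K o a).symm
  have hsmulM : ∀ (o : O) (a : M), o • a = IsLocalRing.residue O o • a := fun o a =>
    (algebraMap_smul F o a).symm
  have htinv : (((t⁻¹ : Oˣ) : O) : K) = z⁻¹ := by
    rw [← ht]
    have : ((t : O) : K) * (((t⁻¹ : Oˣ) : O) : K) = 1 := by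
      exact congrArg (fun o : O => (o : K)) t.mul_inv
    exact eq_inv_of_mul_eq_one_right this
  have hζinv : IsLocalRing.residue O ((t⁻¹ : Oˣ) : O) = ζ⁻¹ := by
    have : ζ * IsLocalRing.residue O ((t⁻¹ : Oˣ) : O) = 1 := by
      rw [← map_mul, t.mul_inv, map_one]
    exact eq_inv_of_mul_eq_one_right this
  have hli := linearIndependent_monom hx hy hz0 hz hxy
  have hunit : ∀ c : ℕ × ℕ →₀ F, c ≠ 0 → IsUnit (Finsupp.linearCombination F (monom x' y') c) :=
    isUnit_linearCombination_generic_monom hprim.pow_eq_one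
  have hxy' : x' * y' = ζ • (y' * x') := by
    have := congrArg μ (genericClock_mul_genericShift (F := F) (n := n) hprim.pow_eq_one)
    rwa [map_mul, map_smul, map_mul] at this
  -- One scalar of `O` governs both planes: `t⁻¹` acts as `z⁻¹` on `E` and as `ζ⁻¹` on `M`.
  have hq : ((y, y') : E × M) * (x, x') = ((t⁻¹ : Oˣ) : O) • ((x, x') * (y, y')) := by
    refine Prod.ext ?_ ?_
    · change y * x = ((t⁻¹ : Oˣ) : O) • (x * y)
      rw [hsmulE, htinv, hxy, smul_smul, inv_mul_cancel₀ hz0, one_smul]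
    · change y' * x' = ((t⁻¹ : Oˣ) : O) • (x' * y')
      rw [hsmulM, hζinv, hxy', smul_smul, inv_mul_cancel₀ hζ0, one_smul]
  have hclock : ∀ α : F, 1 - α • x' = (clockFactor ζ n α).map (algebraMap F[X][X] L) := by
    intro α
    change _ = μ (clockFactor ζ n α)
    rw [clockFactor_eq, map_sub, map_one, map_smul]
    rfl
  have hshift : 1 - y' = (1 - genericShift F n).map (algebraMap F[X][X] L) := by
    change _ = μ (1 - genericShift F n)
    rw [map_sub, map_one]
    rfl
  have hscalar : ∀ κ₀ : F, algebraMap F M κ₀ =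
      (C (C κ₀) • (1 : Matrix (ZMod n) (ZMod n) F[X][X])).map (algebraMap F[X][X] L) := by
    intro κ₀
    change _ = μ (C (C κ₀) • (1 : Matrix (ZMod n) (ZMod n) F[X][X]))
    rw [← μ.commutes κ₀, Algebra.algebraMap_eq_smul_one, ← algebraMap_smul F[X][X] κ₀]
    rfl
  have hux : ∀ α : F, IsUnit (1 - α • x') := fun α => by
    simpa [monom] using isUnit_one_sub_smul_monom hunit α (p := (1, 0)) (by simp)
  have huy : IsUnit (1 - y') := by
    simpa [monom] using isUnit_one_sub_smul_monom hunit 1 (p := (0, 1)) (by simp)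
  obtain ⟨u₁, hu₁⟩ := hux ζ⁻¹
  obtain ⟨u₂, hu₂⟩ := hux 1
  obtain ⟨u₃, hu₃⟩ := hux ζ
  obtain ⟨v, hv⟩ := huy
  let te : Oˣ := t ^ e
  let κ' : Mˣ := Units.map ((algebraMap F M).comp (IsLocalRing.residue O)).toMonoidHom te
  have hinj := lift_injective_generic (L := L) (κ := κ') (κ₀ := IsLocalRing.residue O te) hprim hn h2F
    ((te.isUnit.map (IsLocalRing.residue O)).ne_zero)
    (hu₁.trans (hclock _)) (hu₂.trans (hclock _)) (hu₃.trans (hclock _)) (hv.trans hshift)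
    (hscalar _)
  refine FreeGroup.lift_injective_of_prod _
    (fun g hg h1 => snd_eq_one_of_mem_closure O hli hunit hq hg h1) _ _ ?_ hinj
  have hmem : ∀ (g : Eˣ) (h : Mˣ), ((g : E), (h : M)) ∈ planeSpan O ((x, x') : E × M) (y, y') →
      (g, h) ∈ Subgroup.closure {t : Eˣ × Mˣ |
        ((t.1 : E), (t.2 : M)) ∈ planeSpan O ((x, x') : E × M) (y, y')} := fun g h hgh =>
    Subgroup.subset_closure hgh
  have hone := one_mem_planeSpan (O := O) ((x, x') : E × M) (y, y')
  have hmx : ∀ o : O, (1 - o • x, 1 - o • x') ∈ planeSpan O ((x, x') : E × M) (y, y') := fun o =>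
    sub_mem hone (Submodule.smul_mem _ o (left_mem_planeSpan _ _))
  have hm₁ := hmem U₁ u₁ (by
    rw [hU₁, hu₁, ← htinv, ← hζinv, ← hsmulE, ← hsmulM]; exact hmx _)
  have hm₂ := hmem U₂ u₂ (by
    rw [hU₂, hu₂, one_smul]
    exact sub_mem hone (left_mem_planeSpan _ _))
  have hm₃ := hmem U₃ u₃ (by
    rw [hU₃, hu₃, ← ht, ← hsmulE, ← hsmulM]; exact hmx _)
  have hmV := hmem V v (by
    rw [hV, hv]; exact sub_mem hone (right_mem_planeSpan _ _))
  have hte : ((te : O) : K) = z ^ e := by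
    have h3 : Units.map O.subtype.toMonoidHom t = Units.mk0 z hz0 := Units.ext ht
    have h4 := congrArg Units.val (map_zpow (Units.map O.subtype.toMonoidHom) t e)
    rw [h3, Units.val_zpow_eq_zpow_val, Units.val_mk0] at h4
    exact h4
  have hmκ := hmem κ κ' (by
    have h3 : ((κ : E), (κ' : M)) = (te : O) • (1 : E × M) := by
      refine Prod.ext ?_ ?_
      · change (κ : E) = (te : O) • (1 : E)
        rw [hκ, hsmulE, hte, Algebra.algebraMap_eq_smul_one]
      · change algebraMap F M (IsLocalRing.residue O te) = (te : O) • (1 : M)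
        rw [hsmulM, Algebra.algebraMap_eq_smul_one]
    rw [h3]
    exact Submodule.smul_mem _ _ hone)
  rintro (_ | _)
  · exact mul_mem (mul_mem (pow_mem hmV 2) (mul_mem hmκ (mul_mem hm₃ (inv_mem hm₂))))
      (inv_mem (pow_mem hmV 2))
  · exact mul_mem hm₁ (inv_mem hm₂)

end GenericMatrices

/-! ### Making the commutator a scalar -/

section Centralizer

/-- The centralizer of a set in a division ring is a division ring. -/
noncomputable abbrev Subring.centralizerDivisionRing {D : Type*} [DivisionRing D] (s : Set D) :
    DivisionRing (Subring.centralizer s) :=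
  DivisionRing.ofIsUnitOrEqZero fun a => by
    by_cases h : (a : D) = 0
    · exact Or.inr (Subtype.ext h)
    · refine Or.inl (IsUnit.of_mul_eq_one ⟨(a : D)⁻¹, ?_⟩ (Subtype.ext (mul_inv_cancel₀ h)))
      exact Set.inv_mem_centralizer₀ a.2

theorem exists_unit_centralizer {D : Type*} [DivisionRing D] (z u : Dˣ) (h : Commute z u) :
    ∃ v : (Subring.centralizer ({(z : D)} : Set D))ˣ,
      Units.map (Subring.centralizer ({(z : D)} : Set D)).subtype.toMonoidHom v = u := by
  have h1 : ∀ w : Dˣ, Commute z w → (w : D) ∈ Subring.centralizer ({(z : D)} : Set D) := by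
    intro w hw
    rw [Subring.mem_centralizer_iff]
    intro a ha
    rw [Set.mem_singleton_iff.1 ha]
    exact congrArg Units.val hw.eq
  exact ⟨⟨⟨u, h1 u h⟩, ⟨(u⁻¹ : Dˣ), h1 _ h.inv_right⟩, Subtype.ext u.mul_inv, Subtype.ext u.inv_mul⟩,
    Units.ext rfl⟩

/-- Two explicit free generators in a division ring that contains a Heisenberg group with
commutator of infinite order. -/
theorem lift_injective_of_heisenberg {D : Type*} [DivisionRing D] {x y z : Dˣ} (hzx : Commute z x)
    (hzy : Commute z y) (hxy : x * y = z * (y * x)) (hz : ∀ m : ℕ, 0 < m → z ^ m ≠ 1)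
    (h2 : (2 : D) ≠ 0) (e : ℤ) {U₁ U₂ U₃ V : Dˣ}
    (hU₁ : (U₁ : D) = 1 - (z⁻¹ * x : Dˣ)) (hU₂ : (U₂ : D) = 1 - x)
    (hU₃ : (U₃ : D) = 1 - (z * x : Dˣ)) (hV : (V : D) = 1 - y) :
    Function.Injective (FreeGroup.lift fun b : Bool =>
      cond b (U₁ * U₂⁻¹) (V ^ 2 * (z ^ e * (U₃ * U₂⁻¹)) * (V ^ 2)⁻¹)) := by
  let E := Subring.centralizer ({(z : D)} : Set D)
  let _ : DivisionRing E := Subring.centralizerDivisionRing _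
  let j : Eˣ →* Dˣ := Units.map E.subtype.toMonoidHom
  have hj : Function.Injective j := Units.map_injective Subtype.val_injective
  have hcomm : ∀ u a : Dˣ, Commute z a → (u : D) = 1 - a → Commute z u := fun u a ha hu =>
    Units.ext (by
      rw [Units.val_mul, Units.val_mul, hu, mul_sub, sub_mul, ← Units.val_mul, ← Units.val_mul,
        ha.eq, mul_one, one_mul])
  obtain ⟨x', hx'⟩ := exists_unit_centralizer z x hzx
  obtain ⟨y', hy'⟩ := exists_unit_centralizer z y hzy
  obtain ⟨z', hz'⟩ := exists_unit_centralizer z z (Commute.refl z)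
  obtain ⟨u₁, hu₁⟩ := exists_unit_centralizer z U₁
    (hcomm _ _ ((Commute.refl z).inv_right.mul_right hzx) hU₁)
  obtain ⟨u₂, hu₂⟩ := exists_unit_centralizer z U₂ (hcomm _ _ hzx hU₂)
  obtain ⟨u₃, hu₃⟩ := exists_unit_centralizer z U₃
    (hcomm _ _ ((Commute.refl z).mul_right hzx) hU₃)
  obtain ⟨v, hv⟩ := exists_unit_centralizer z V (hcomm _ _ hzy hV)
  have hval : ∀ (a : Eˣ) (b : Dˣ), j a = b → ((a : E) : D) = b := fun a b h => by rw [← h]; rfl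
  -- In its own centralizer `z` is central, so the quantum plane can be taken over the center of
  -- `E`.
  have hzc : (z' : E) ∈ Subring.center E := by
    rw [Subring.mem_center_iff]
    intro g
    apply Subtype.ext
    change (g : D) * ((z' : E) : D) = ((z' : E) : D) * (g : D)
    rw [hval z' z hz']
    exact (Subring.mem_centralizer_iff.1 g.2 (z : D) rfl).symm
  let zc : Subring.center E := ⟨z', hzc⟩
  have hzc0 : zc ≠ 0 := fun h => z'.ne_zero (congrArg Subtype.val h)
  have hzE : ∀ k : ℤ, ((zc ^ k : Subring.center E) : E) = ((z' ^ k : Eˣ) : E) := by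
    intro k
    rw [Units.val_zpow_eq_zpow_val]
    exact map_zpow₀ (algebraMap (Subring.center E) E) zc k
  have hsmul : ∀ (c : Subring.center E) (a : E), c • a = (c : E) * a := fun _ _ => rfl
  have key := lift_injective_of_qcomm (K := Subring.center E) (E := E) (x := x') (y := y') (z := zc)
    x'.ne_zero y'.ne_zero hzc0 ?_ ?_ ?_ e (U₁ := u₁) (U₂ := u₂) (U₃ := u₃) (V := v) (κ := z' ^ e)
    ?_ ?_ ?_ ?_ ?_
  · have h3 : (FreeGroup.lift fun b : Bool =>
        cond b (U₁ * U₂⁻¹) (V ^ 2 * (z ^ e * (U₃ * U₂⁻¹)) * (V ^ 2)⁻¹)) =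
        j.comp (FreeGroup.lift fun b : Bool =>
          cond b (u₁ * u₂⁻¹) (v ^ 2 * (z' ^ e * (u₃ * u₂⁻¹)) * (v ^ 2)⁻¹)) := by
      apply FreeGroup.ext_hom
      have e1 : j u₁ = U₁ := hu₁
      have e2 : j u₂ = U₂ := hu₂
      have e3 : j u₃ = U₃ := hu₃
      have e4 : j v = V := hv
      have e5 : j z' = z := hz'
      rintro (_ | _) <;> simp [e1, e2, e3, e4, e5]
    rw [h3]
    exact hj.comp key
  · intro m hm h
    apply hz m hm
    have h3 : z' ^ m = 1 := Units.ext (by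
      have := congrArg Subtype.val h
      simpa [zc] using this)
    rw [← hz', ← map_pow, h3, map_one]
  · intro h
    apply h2
    have h3 := congrArg (E.subtype.comp (Subring.center E).subtype) h
    rwa [map_ofNat, map_zero] at h3
  · rw [hsmul]
    have : x' * y' = z' * (y' * x') := hj (by
      simp only [map_mul]
      rw [show j x' = x from hx', show j y' = y from hy', show j z' = z from hz', hxy])
    exact congrArg Units.val this
  · rw [hsmul]
    have h3 := hzE (-1)
    rw [zpow_neg_one, zpow_neg_one] at h3
    rw [h3]
    apply Subtype.ext
    have h4 : j (z'⁻¹ * x') = z⁻¹ * x := by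
      rw [map_mul, map_inv, show j x' = x from hx', show j z' = z from hz']
    rw [hval _ _ hu₁, hU₁, ← hval _ _ h4]
    rfl
  · apply Subtype.ext
    rw [hval _ _ hu₂, hU₂, ← hx']
    rfl
  · rw [hsmul]
    apply Subtype.ext
    have h4 : j (z' * x') = z * x := by
      rw [map_mul, show j x' = x from hx', show j z' = z from hz']
    rw [hval _ _ hu₃, hU₃, ← hval _ _ h4]
    rfl
  · apply Subtype.ext
    rw [hval _ _ hv, hV, ← hy']
    rfl
  · exact (hzE e).symm

end Centralizer

/-! ### Manipulating pairs of free generators -/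

section FreePairs

/-- The action of the permutations of the basis on a free group. -/
def FreeGroup.permHom (α : Type*) : Equiv.Perm α →* MulAut (FreeGroup α) :=
  MonoidHom.mk' (fun σ => FreeGroup.freeGroupCongr σ) fun σ τ => by
    ext w
    change FreeGroup.map _ w = FreeGroup.map _ (FreeGroup.map _ w)
    rw [FreeGroup.map.comp]
    rfl

/-- In a free group with basis `p, q` the elements `p * q` and `q * p` are free generators. -/
theorem FreeGroup.lift_mul_swap_injective : Function.Injective (FreeGroup.lift fun b : Bool =>
    cond b (FreeGroup.of true * FreeGroup.of false) (FreeGroup.of false * FreeGroup.of true)) := by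
  let s : FreeGroup Bool ⋊[FreeGroup.permHom Bool] Equiv.Perm Bool :=
    SemidirectProduct.inr (Equiv.swap true false)
  let a : FreeGroup Bool ⋊[FreeGroup.permHom Bool] Equiv.Perm Bool :=
    SemidirectProduct.inl (FreeGroup.of true)
  have hs : s * s = 1 :=
    (_root_.map_mul SemidirectProduct.inr _ _).symm.trans
      (by rw [Equiv.swap_mul_self, _root_.map_one])
  have hsa : s * a * s = SemidirectProduct.inl (FreeGroup.of false) := by
    have h1 := SemidirectProduct.inl_aut (φ := FreeGroup.permHom Bool) (Equiv.swap true false)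
      (FreeGroup.of true)
    rw [Equiv.swap_inv] at h1
    exact h1.symm
  -- With `s` the swap, `p ↦ s` and `q ↦ s * a` send `p * q` to `a` and `q * p` to `s * a * s`, the
  -- two standard free generators.
  let ψ : FreeGroup Bool →* FreeGroup Bool ⋊[FreeGroup.permHom Bool] Equiv.Perm Bool :=
    FreeGroup.lift fun b => cond b s (s * a)
  have h : ψ.comp (FreeGroup.lift fun b : Bool => cond b (FreeGroup.of true * FreeGroup.of false)
      (FreeGroup.of false * FreeGroup.of true)) = SemidirectProduct.inl := by
    apply FreeGroup.ext_hom
    rintro (_ | _)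
    · simp [ψ, hsa]
    · simp [ψ, ← mul_assoc, hs, a]
  have h3 : Function.Injective (ψ ∘ (FreeGroup.lift fun b : Bool =>
      cond b (FreeGroup.of true * FreeGroup.of false)
      (FreeGroup.of false * FreeGroup.of true))) := by
    rw [← MonoidHom.coe_comp, h]
    exact SemidirectProduct.inl_injective
  exact h3.of_comp

variable {A : Type*} [Group A]

theorem lift_mul_swap_injective_of_lift_injective {p q : A}
    (h : Function.Injective (FreeGroup.lift fun b : Bool => cond b p q)) :
    Function.Injective (FreeGroup.lift fun b : Bool => cond b (p * q) (q * p)) := by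
  have h1 : (FreeGroup.lift fun b : Bool => cond b (p * q) (q * p)) =
      (FreeGroup.lift fun b : Bool => cond b p q).comp (FreeGroup.lift fun b : Bool =>
        cond b (FreeGroup.of true * FreeGroup.of false)
          (FreeGroup.of false * FreeGroup.of true)) := by
    apply FreeGroup.ext_hom
    rintro (_ | _) <;> simp
  rw [h1]
  exact h.comp FreeGroup.lift_mul_swap_injective

theorem lift_inv_injective_of_lift_injective {p q : A}
    (h : Function.Injective (FreeGroup.lift fun b : Bool => cond b p q)) :
    Function.Injective (FreeGroup.lift fun b : Bool => cond b p q⁻¹) := by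
  let ν : FreeGroup Bool →* FreeGroup Bool :=
    FreeGroup.lift fun b => cond b (FreeGroup.of true) (FreeGroup.of false)⁻¹
  have hν : ν.comp ν = MonoidHom.id _ := by
    apply FreeGroup.ext_hom
    rintro (_ | _) <;> simp [ν]
  have hν' : Function.Injective ν :=
    Function.LeftInverse.injective (g := ν) fun w => DFunLike.congr_fun hν w
  have h1 : (FreeGroup.lift fun b : Bool => cond b p q⁻¹) =
      (FreeGroup.lift fun b : Bool => cond b p q).comp ν := by
    apply FreeGroup.ext_hom
    rintro (_ | _) <;> simp [ν]
  rw [h1]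
  exact h.comp hν'

theorem lift_conj_injective_of_lift_injective {p q : A} (g : A)
    (h : Function.Injective (FreeGroup.lift fun b : Bool => cond b p q)) :
    Function.Injective (FreeGroup.lift fun b : Bool => cond b (g⁻¹ * p * g) (g⁻¹ * q * g)) := by
  have h1 : (FreeGroup.lift fun b : Bool => cond b (g⁻¹ * p * g) (g⁻¹ * q * g)) =
      (MulAut.conj g⁻¹).toMonoidHom.comp (FreeGroup.lift fun b : Bool => cond b p q) := by
    apply FreeGroup.ext_hom
    rintro (_ | _) <;> simp
  rw [h1]
  exact (MulAut.conj g⁻¹).injective.comp h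

/-- Free generators generate a free noncyclic subgroup. -/
theorem isFreeGroup_closure_pair {p q : A}
    (h : Function.Injective (FreeGroup.lift fun b : Bool => cond b p q)) :
    IsFreeGroup (Subgroup.closure ({p, q} : Set A)) ∧
      ¬ IsCyclic (Subgroup.closure ({p, q} : Set A)) := by
  have hrange : (FreeGroup.lift fun b : Bool => cond b p q).range = Subgroup.closure {p, q} := by
    rw [FreeGroup.range_lift_eq_closure]
    congr 1
    ext a
    simp [eq_comm, or_comm]
  refine ⟨?_, fun hcyc => ?_⟩
  · rw [← hrange]
    exact IsFreeGroup.ofMulEquiv (MonoidHom.ofInjective h)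
  · have hp : p ∈ Subgroup.closure ({p, q} : Set A) := Subgroup.subset_closure (by simp)
    have hq : q ∈ Subgroup.closure ({p, q} : Set A) := Subgroup.subset_closure (by simp)
    have hpq : p * q = q * p := by
      have := IsCyclic.isMulCommutative (α := Subgroup.closure ({p, q} : Set A))
      exact congrArg Subtype.val (this.is_comm.comm ⟨p, hp⟩ ⟨q, hq⟩)
    have h1 : FreeGroup.of true * FreeGroup.of false = FreeGroup.of false * FreeGroup.of true :=
      h (by simpa using hpq)
    revert h1
    decide

end FreePairs

/-! ### Symmetric and unitary Heisenberg generators -/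

section Involution

variable {D : Type*} [DivisionRing D]

theorem one_sub_ne_zero_of_not_commute {a b : Dˣ} (h : a * b ≠ b * a) : (1 : D) - a ≠ 0 := by
  intro h0
  have : a = 1 := Units.ext (sub_eq_zero.1 h0).symm
  exact h (by rw [this, one_mul, mul_one])

theorem commute_of_eq_one_sub {u v a b : Dˣ} (hu : (u : D) = 1 - a) (hv : (v : D) = 1 - b)
    (hab : Commute a b) : Commute u v := by
  apply Units.ext
  have h := congrArg Units.val hab.eq
  rw [Units.val_mul, Units.val_mul] at h ⊢
  rw [hu, hv, sub_mul, mul_sub, mul_sub, sub_mul, mul_sub, mul_sub, h]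
  simp only [mul_one, one_mul]
  abel

/-- Conjugation of `1 - a`. -/
theorem conj_eq_of_eq_one_sub {u v a b g : Dˣ} (hu : (u : D) = 1 - a) (hv : (v : D) = 1 - b)
    (hab : g * a = b * g) : g * u = v * g := by
  apply Units.ext
  have h := congrArg Units.val hab
  rw [Units.val_mul, Units.val_mul] at h ⊢
  rw [hu, hv, mul_sub, sub_mul, h, mul_one, one_mul]

variable [StarRing D]

theorem val_star_of_eq_one_sub {u a : Dˣ} (hu : (u : D) = 1 - a) :
    ((star u : Dˣ) : D) = 1 - (star a : Dˣ) := by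
  rw [Units.coe_star, hu, star_sub, star_one, Units.coe_star]

theorem star_eq_of_eq_one_sub {u v a b : Dˣ} (hu : (u : D) = 1 - a) (hv : (v : D) = 1 - b)
    (hab : star a = b) : star u = v :=
  Units.ext (by rw [val_star_of_eq_one_sub hu, hab, hv])

theorem star_eq_neg_mul_of_eq_one_sub {u a : Dˣ} (hu : (u : D) = 1 - a) (hab : star a = a⁻¹) :
    star u = -(a⁻¹ * u) := by
  apply Units.ext
  rw [val_star_of_eq_one_sub hu, hab, Units.val_neg, Units.val_mul, hu, mul_sub, mul_one,
    Units.inv_mul]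
  abel

/-- A division ring with involution that contains a Heisenberg group with generators `x`, `y` which
are symmetric or unitary contains elements `w` such that `w` and `star w` are free generators. -/
theorem exists_free_star_pair {N : Subgroup Dˣ} (hN : N.Normal) {x y z : Dˣ} (hyN : y ∈ N)
    (hzx : Commute z x) (hzy : Commute z y) (hxy : x * y = z * (y * x))
    (hz : ∀ m : ℕ, 0 < m → z ^ m ≠ 1) (h2 : (2 : D) ≠ 0)
    (hcases : (star x = x ∧ star y = y) ∨ (star x = x ∧ star y = y⁻¹) ∨
      (star x = x⁻¹ ∧ star y = y⁻¹)) :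
    ∃ w ∈ N, Function.Injective (FreeGroup.lift fun b : Bool => cond b w (star w)) := by
  have hz1 : z ≠ 1 := fun h => hz 1 one_pos (by rw [h, one_pow])
  have hyx : y * x = z⁻¹ * (x * y) := by rw [hxy, inv_mul_cancel_left]
  -- For `c = z⁻¹, 1, z` this shows that `c * x` is not `1`, so `1 - c * x` is invertible.
  have hncomm : ∀ c : Dˣ, Commute c y → c * x * y ≠ y * (c * x) := by
    intro c hc h
    rw [mul_assoc, hxy, ← mul_assoc y, ← hc.eq, mul_assoc c y x] at h
    have h3 := mul_left_cancel h
    exact hz1 (mul_eq_right.1 h3)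
  have hu1 := one_sub_ne_zero_of_not_commute (hncomm z⁻¹ hzy.inv_left)
  have hu2 := one_sub_ne_zero_of_not_commute (a := x) (b := y)
    (by simpa using hncomm 1 (Commute.one_left y))
  have hu3 := one_sub_ne_zero_of_not_commute (hncomm z hzy)
  have hu4 := one_sub_ne_zero_of_not_commute (a := y) (b := x)
    (by simpa [eq_comm] using hncomm 1 (Commute.one_left y))
  obtain ⟨U₁, hU₁⟩ : ∃ U : Dˣ, (U : D) = 1 - (z⁻¹ * x : Dˣ) := ⟨Units.mk0 _ hu1, rfl⟩
  obtain ⟨U₂, hU₂⟩ : ∃ U : Dˣ, (U : D) = 1 - x := ⟨Units.mk0 _ hu2, rfl⟩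
  obtain ⟨U₃, hU₃⟩ : ∃ U : Dˣ, (U : D) = 1 - (z * x : Dˣ) := ⟨Units.mk0 _ hu3, rfl⟩
  obtain ⟨V, hV⟩ : ∃ U : Dˣ, (U : D) = 1 - y := ⟨Units.mk0 _ hu4, rfl⟩
  have hcx : Commute x (z * x) := hzx.symm.mul_right (Commute.refl x)
  have hc23 : Commute U₂ U₃ := commute_of_eq_one_sub hU₂ hU₃ hcx
  have hy21 : y * U₂ = U₁ * y := conj_eq_of_eq_one_sub hU₂ hU₁ (by rw [hyx, mul_assoc])
  have hy32 : y * U₃ = U₂ * y := conj_eq_of_eq_one_sub hU₃ hU₂ (by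
    rw [hxy, ← mul_assoc, ← hzy.eq, mul_assoc])
  have hyV : Commute y V := conj_eq_of_eq_one_sub hV hV rfl
  have hzV : Commute z V := conj_eq_of_eq_one_sub hV hV hzy
  have hzU₂ : Commute z U₂ := conj_eq_of_eq_one_sub hU₂ hU₂ hzx
  have hzyx : Commute z (y * x) := hzy.mul_right hzx
  have hfree := fun e : ℤ => lift_injective_of_heisenberg hzx hzy hxy hz h2 e hU₁ hU₂ hU₃ hV
  have hwN : U₁ * U₂⁻¹ ∈ N := by
    -- Since `U₁` is the conjugate of `U₂` by `y`, the quotient is a commutator with `y ∈ N`.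
    have h3 : U₁ * U₂⁻¹ = y * (U₂ * y⁻¹ * U₂⁻¹) := by
      rw [← mul_assoc, ← mul_assoc, hy21, mul_inv_cancel_right]
    rw [h3]
    exact mul_mem hyN (hN.conj_mem _ (inv_mem hyN) U₂)
  refine ⟨V⁻¹ * (U₁ * U₂⁻¹) * V, by simpa using hN.conj_mem _ hwN V⁻¹, ?_⟩
  have hstarw : star (V⁻¹ * (U₁ * U₂⁻¹) * V) =
      star V * ((star U₂)⁻¹ * star U₁) * (star V)⁻¹ := by
    simp only [star_mul, star_inv, mul_assoc]
  have hsz := congrArg star hxy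
  simp only [star_mul] at hsz
  rcases hcases with ⟨hx, hy⟩ | ⟨hx, hy⟩ | ⟨hx, hy⟩
  · have hzs : star z = z⁻¹ := by
      rw [hx, hy, hxy, hzyx.eq, mul_assoc] at hsz
      exact eq_inv_of_mul_eq_one_right (mul_eq_left.1 hsz.symm)
    have h1 : star U₁ = U₃ := star_eq_of_eq_one_sub hU₁ hU₃ (by
      rw [star_mul, star_inv, hzs, inv_inv, hx, hzx.eq])
    have h3 : star U₂ = U₂ := star_eq_of_eq_one_sub hU₂ hU₂ hx
    have h4 : star V = V := star_eq_of_eq_one_sub hV hV hy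
    have h5 : star (V⁻¹ * (U₁ * U₂⁻¹) * V) =
        V⁻¹ * (V ^ 2 * (z ^ (0 : ℤ) * (U₃ * U₂⁻¹)) * (V ^ 2)⁻¹) * V := by
      rw [hstarw, h1, h3, h4, hc23.inv_left.eq]
      group
    rw [h5]
    exact lift_conj_injective_of_lift_injective V (hfree 0)
  all_goals
    have h4 : star V = -(y⁻¹ * V) := star_eq_neg_mul_of_eq_one_sub hV hy
    -- Here `star V = -(y⁻¹ * V)`: the sign cancels, and conjugation by `y⁻¹` takes `U₁` to `U₂` and
    -- `U₂` to `U₃`.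
    have hconj : star V * (U₂⁻¹ * U₁) * (star V)⁻¹ = V * (U₂ * U₃⁻¹) * V⁻¹ := by
      have e1 : U₂⁻¹ * y = y * U₃⁻¹ := by
        rw [inv_mul_eq_iff_eq_mul, ← mul_assoc, ← hy32, mul_inv_cancel_right]
      calc star V * (U₂⁻¹ * U₁) * (star V)⁻¹ = y⁻¹ * V * (U₂⁻¹ * U₁) * (y⁻¹ * V)⁻¹ := by
            rw [h4, inv_neg, neg_mul, neg_mul_neg]
        _ = V * y⁻¹ * (U₂⁻¹ * U₁) * (V * y⁻¹)⁻¹ := by rw [hyV.inv_left.eq]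
        _ = V * (y⁻¹ * U₂⁻¹ * (U₁ * y)) * V⁻¹ := by group
        _ = V * (y⁻¹ * (U₂⁻¹ * y) * U₂) * V⁻¹ := by rw [← hy21]; simp only [mul_assoc]
        _ = V * (U₂ * U₃⁻¹) * V⁻¹ := by
          rw [e1, inv_mul_cancel_left, hc23.inv_right.eq]
  · have hzs : star z = z := by
      have e1 : y⁻¹ * x = x * y⁻¹ * z := by
        rw [inv_mul_eq_iff_eq_mul, mul_assoc x, ← hzy.inv_right.eq, ← mul_assoc, ← mul_assoc,
          eq_mul_inv_iff_mul_eq, hxy, hzyx.eq]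
      rw [hx, hy, e1] at hsz
      exact (mul_left_cancel hsz).symm
    have h1 : star U₁ = U₁ := star_eq_of_eq_one_sub hU₁ hU₁ (by
      rw [star_mul, star_inv, hzs, hx, hzx.inv_left.eq])
    have h3 : star U₂ = U₂ := star_eq_of_eq_one_sub hU₂ hU₂ hx
    have h5 : star (V⁻¹ * (U₁ * U₂⁻¹) * V) =
        V⁻¹ * (V ^ 2 * (z ^ (0 : ℤ) * (U₃ * U₂⁻¹)) * (V ^ 2)⁻¹)⁻¹ * V := by
      rw [hstarw, h1, h3, hconj]
      group
    rw [h5]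
    exact lift_conj_injective_of_lift_injective V (lift_inv_injective_of_lift_injective (hfree 0))
  · have hzs : star z = z⁻¹ := by
      have e1 : y⁻¹ * x⁻¹ = x⁻¹ * y⁻¹ * z⁻¹ := by
        rw [← mul_inv_rev, hxy, mul_inv_rev, mul_inv_rev]
      rw [hx, hy, e1] at hsz
      exact (mul_left_cancel hsz).symm
    have h1 : star U₁ = -((z⁻¹ * x)⁻¹ * U₁) := star_eq_neg_mul_of_eq_one_sub hU₁ (by
      rw [star_mul, star_inv, hzs, hx, mul_inv_rev])
    have h3 : star U₂ = -(x⁻¹ * U₂) := star_eq_neg_mul_of_eq_one_sub hU₂ hx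
    -- The unitary factors leave an extra `z`; after inversion this is the exponent `e = -1`.
    have h6 : (star U₂)⁻¹ * star U₁ = z * (U₂⁻¹ * U₁) := by
      rw [h1, h3, inv_neg, neg_mul_neg, ← mul_assoc z, hzU₂.inv_right.eq]
      group
    have hzs : Commute z (star V) := by
      rw [h4]
      exact (hzy.inv_right.mul_right hzV).neg_right
    have h5 : star (V⁻¹ * (U₁ * U₂⁻¹) * V) =
        V⁻¹ * (V ^ 2 * (z ^ (-1 : ℤ) * (U₃ * U₂⁻¹)) * (V ^ 2)⁻¹)⁻¹ * V := by
      calc star (V⁻¹ * (U₁ * U₂⁻¹) * V) = star V * z * (U₂⁻¹ * U₁) * (star V)⁻¹ := by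
            rw [hstarw, h6]; simp only [mul_assoc]
        _ = z * (V * (U₂ * U₃⁻¹) * V⁻¹) := by rw [← hzs.eq, ← hconj]; simp only [mul_assoc]
        _ = V * (U₂ * U₃⁻¹) * V⁻¹ * z := by
          have hzU₃ : Commute z U₃ :=
            conj_eq_of_eq_one_sub hU₃ hU₃ ((Commute.refl z).mul_right hzx)
          exact (hzV.mul_right (hzU₂.mul_right hzU₃.inv_right)).mul_right hzV.inv_right
        _ = V * (U₂ * U₃⁻¹) * (V⁻¹ * z) := by simp only [mul_assoc]
        _ = V * (U₂ * U₃⁻¹) * (z * V⁻¹) := by rw [hzV.inv_right.eq]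
        _ = _ := by group
    rw [h5]
    exact lift_conj_injective_of_lift_injective V
      (lift_inv_injective_of_lift_injective (hfree (-1)))

end Involution

/-! ### Assembly of the free symmetric pair -/

theorem isFreeSymmetricPair_of_lift_injective {D : Type*} [DivisionRing D] [StarRing D] {w : Dˣ}
    (h : Function.Injective (FreeGroup.lift fun b : Bool => cond b w (star w))) :
    IsFreeSymmetricPair (w * star w) (star w * w) :=
  ⟨by rw [star_mul, star_star], by rw [star_mul, star_star],
    isFreeGroup_closure_pair (lift_mul_swap_injective_of_lift_injective h)⟩

/-- A torsion-free nilpotent-by-finite group that is not abelian-by-finite, with an involutive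
automorphism `φ`, contains two noncommuting elements, each of them fixed or inverted by `φ`, that
commute with their commutator. -/
theorem exists_fixed_or_inverted_pair_of_isVirtuallyNilpotent {G : Type*} [Group G] (φ : G →* G)
    (hφ : ∀ g, φ (φ g) = g) (htf : IsTorsionFreeGroup G) (hnil : Group.IsVirtuallyNilpotent G)
    (hab : ¬ IsAbelianByFinite G) :
    ∃ x y z : G, (φ x = x ∨ φ x = x⁻¹) ∧ (φ y = y ∨ φ y = y⁻¹) ∧ z ≠ 1 ∧
      x * y = z * (y * x) ∧ Commute z x ∧ Commute z y := by
  obtain ⟨H₀, hH₀, hfin⟩ := hnil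
  -- Intersecting with the preimage makes the subgroup `φ`-invariant and keeps it nilpotent of
  -- finite index.
  let H : Subgroup G := H₀ ⊓ H₀.comap φ
  have hHfin : H.FiniteIndex := ⟨Subgroup.index_inf_ne_zero hfin.index_ne_zero
    (by rw [Subgroup.index_comap_of_surjective H₀ fun g => ⟨φ g, hφ g⟩]; exact hfin.index_ne_zero)⟩
  have hHnil : Group.IsNilpotent H := by
    refine Subgroup.isNilpotent_of_ker_le_center (Subgroup.inclusion (inf_le_left : H ≤ H₀)) ?_
    rw [(MonoidHom.ker_eq_bot_iff _).2 (Subgroup.inclusion_injective _)]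
    exact bot_le
  have hφH : ∀ h : H, φ h ∈ H := fun h => ⟨h.2.2, by
    change φ (φ h) ∈ H₀
    rw [hφ]
    exact h.2.1⟩
  let ψ : H →* H := MonoidHom.mk' (fun h => ⟨φ h, hφH h⟩) fun a b =>
    Subtype.ext (map_mul φ (a : G) (b : G))
  have hψ : ∀ h, ψ (ψ h) = h := fun h => Subtype.ext (hφ h)
  have hHtf : IsTorsionFreeGroup H := fun h hh =>
    Subtype.ext (htf h (Submonoid.isOfFinOrder_coe.2 hh))
  have hHab : ∃ a b : H, a * b ≠ b * a := by
    by_contra! hcon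
    exact hab ⟨H, fun a ha b hb => congrArg Subtype.val (hcon ⟨a, ha⟩ ⟨b, hb⟩), hHfin⟩
  obtain ⟨x, y, hx, hy, hne, hcen⟩ := exists_fixed_or_inverted_pair ψ hψ hHtf hHab
  have hc := Subgroup.mem_center_iff.1 hcen
  refine ⟨x, y, (x : G) * y * (x : G)⁻¹ * (y : G)⁻¹, ?_, ?_, fun h => hne (Subtype.ext h), ?_, ?_, ?_⟩
  · exact hx.imp (congrArg Subtype.val) (congrArg Subtype.val)
  · exact hy.imp (congrArg Subtype.val) (congrArg Subtype.val)
  · group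
  · exact (congrArg Subtype.val (hc x)).symm
  · exact (congrArg Subtype.val (hc y)).symm

theorem theoremT {D : Type*} [DivisionRing D] [StarRing D]
    (hchar : ringChar (Subring.center D) ≠ 2)
    (hstar : IsCenterLinearStar D)
    (N : Subgroup Dˣ) (hN : N.Normal) (hNstar : IsStarInvariant N)
    (G : Subgroup Dˣ) (hGN : G ≤ N) (hGstar : IsStarInvariant G)
    (hGtf : IsTorsionFreeGroup G)
    (hGnil : Group.IsVirtuallyNilpotent G)
    (hGab : ¬ IsAbelianByFinite G) :
    ∃ x ∈ N, ∃ y ∈ N, IsFreeSymmetricPair x y := by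
  have h2 : (2 : D) ≠ 0 := by
    intro h
    exact Ring.two_ne_zero hchar (Subtype.ext h)
  -- Elements fixed by `φ` are unitary; elements inverted by `φ` are symmetric.
  let φ : G →* G := MonoidHom.mk' (fun g => ⟨(star (g : Dˣ))⁻¹, inv_mem (hGstar g g.2)⟩) fun a b =>
    Subtype.ext (by simp [star_mul])
  have hφ : ∀ g, φ (φ g) = g := fun g => Subtype.ext (by simp [φ, star_inv])
  have hφfix : ∀ g : G, φ g = g → star (g : Dˣ) = (g : Dˣ)⁻¹ := fun g h =>
    inv_eq_iff_eq_inv.1 (congrArg Subtype.val h)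
  have hφinv : ∀ g : G, φ g = g⁻¹ → star (g : Dˣ) = g := fun g h =>
    inv_injective (congrArg Subtype.val h)
  obtain ⟨x, y, z, hx, hy, hz1, hxy, hzx, hzy⟩ :=
    exists_fixed_or_inverted_pair_of_isVirtuallyNilpotent φ hφ hGtf hGnil hGab
  have hz : ∀ m : ℕ, 0 < m → (z : Dˣ) ^ m ≠ 1 := fun m hm h =>
    hz1 (hGtf z (isOfFinOrder_iff_pow_eq_one.2 ⟨m, hm, Subtype.ext h⟩))
  have hxy' : (x : Dˣ) * y = z * (y * x) := congrArg Subtype.val hxy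
  have hzx' : Commute (z : Dˣ) x := congrArg Subtype.val hzx.eq
  have hzy' : Commute (z : Dˣ) y := congrArg Subtype.val hzy.eq
  have hfree : ∃ w ∈ N, Function.Injective (FreeGroup.lift fun b : Bool => cond b w (star w)) := by
    rcases hy with hy | hy
    · exact exists_free_star_pair hN (hGN y.2) hzx' hzy' hxy' hz h2
        (hx.elim (fun hx => Or.inr (Or.inr ⟨hφfix x hx, hφfix y hy⟩))
          fun hx => Or.inr (Or.inl ⟨hφinv x hx, hφfix y hy⟩))
    · rcases hx with hx | hx
      -- For `x` unitary and `y` symmetric the roles are exchanged, which replaces `z` by `z⁻¹`.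
      · exact exists_free_star_pair hN (hGN x.2) hzy'.inv_left hzx'.inv_left
          (by rw [hxy', inv_mul_cancel_left])
          (fun m hm h => hz m hm (by rwa [inv_pow, inv_eq_one] at h)) h2
          (Or.inr (Or.inl ⟨hφinv y hy, hφfix x hx⟩))
      · exact exists_free_star_pair hN (hGN y.2) hzx' hzy' hxy' hz h2
          (Or.inl ⟨hφinv x hx, hφinv y hy⟩)
  obtain ⟨w, hw, hinj⟩ := hfree
  have hw' := hNstar w hw
  exact ⟨w * star w, mul_mem hw hw', star w * w, mul_mem hw' hw,
    isFreeSymmetricPair_of_lift_injective hinj⟩
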